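/- **Proposition.** Let $\tau\in\mathbb{C}$ with $\operatorname{Im}\tau>0$, write $q^{s}=e^{2\pi i s\tau}$ for $s\in\mathbb{C}$, and let $(-i\tau)^{1/2}$ denote the principal branch. For $a,b\in\{0,1\}$ let $$\vartheta_{ab}(\tau,z)=\sum_{n\in\mathbb{Z}}e^{\pi i(n+\frac a2)^2\tau+2\pi i(n+\frac a2)(z+\frac b2)}$$ be Mumford's theta functions. Define $$f_1=\sum_{j\in\mathbb{Z}}\frac{e^{2\pi ijz}q^{\frac12j^2}}{1-e^{2\pi iz}q^{j}},\quad f_2=\sum_{j\in\mathbb{Z}}(-1)^j\frac{e^{2\pi i(j+\frac12)z}q^{\frac12(j+\frac12)^2}}{1+e^{2\pi iz}q^{j+\frac12}},\quad f_3=\sum_{j\in\mathbb{Z}}(-1)^j\frac{e^{2\pi ijz}q^{\frac12j^2}}{1+e^{2\pi iz}q^{j}},\quad f_4=\sum_{j\in\mathbb{Z}}\frac{e^{2\pi i(j+\frac12)z}q^{\frac12(j+\frac12)^2}}{1-e^{2\pi iz}q^{j+\frac12}},$$ $$g_1=\sum_{j\in\mathbb{Z}}\frac{e^{2\pi i(j-\frac12)z}q^{\frac12j(j-1)}}{1-e^{2\pi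 iz}q^{j}},\quad g_2=\sum_{j\in\mathbb{Z}}(-1)^j\frac{e^{2\pi i(j-\frac12)z}q^{\frac12j(j-1)}}{1+e^{2\pi iz}q^{j}},\quad g_3=\sum_{j\in\mathbb{Z}}\frac{e^{2\pi ijz}q^{\frac12(j^2-\frac14)}}{1-e^{2\pi iz}q^{j+\frac12}},\quad g_4=\sum_{j\in\mathbb{Z}}(-1)^j\frac{e^{2\pi ijz}q^{\frac12(j^2-\frac14)}}{1+e^{2\pi iz}q^{j+\frac12}},$$ $$h_1=\sum_{j\in\mathbb{Z}}(-1)^j\frac{e^{2\pi ijz}q^{\frac12j^2}}{1-e^{2\pi iz}q^{j}},\quad h_2=\sum_{j\in\mathbb{Z}}(-1)^j\frac{e^{2\pi i(j+\frac12)z}q^{\frac12(j+\frac12)^2}}{1-e^{2\pi iz}q^{j+\frac12}},\quad h_3=\sum_{j\in\mathbb{Z}}\frac{e^{2\pi ijz}q^{\frac12j^2}}{1+e^{2\pi iz}q^{j}},\quad h_4=\sum_{j\in\mathbb{Z}}\frac{e^{2\pi i(j+\frac12)z}q^{\frac12(j+\frac12)^2}}{1+e^{2\pi iz}q^{j+\frac12}},$$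 all as functions of $(\tau,z)$. Then each of the following identities holds for every $z\in\mathbb{C}$ at which no denominator in it vanishes (the functions without displayed argument, on the right-hand sides, are taken at $(\tau,z)$). 1) $S$-transformation: $$\begin{aligned} f_1(-\tfrac1\tau,\tfrac z\tau)&=e^{\pi iz^2/\tau}\{\tau f_1-\tfrac12\tau\vartheta_{00}+\tfrac12(-i\tau)^{1/2}\vartheta_{00}\},\\ f_2(-\tfrac1\tau,\tfrac z\tau)&=e^{\pi iz^2/\tau}\{-i\tau f_2+\tfrac12\tau\vartheta_{11}-\tfrac12(-i\tau)^{1/2}\vartheta_{11}\},\\ f_3(-\tfrac1\tau,\tfrac z\tau)&=e^{\pi iz^2/\tau}\{\tau f_4-\tfrac12\tau\vartheta_{10}+\tfrac12(-i\tau)^{1/2}\vartheta_{10}\},\\ f_4(-\tfrac1\tau,\tfrac z\tau)&=e^{\pi iz^2/\tau}\{\tau f_3-\tfrac12\tau\vartheta_{01}+\tfrac12(-i\tau)^{1/2}\vartheta_{01}\},\\ g_1(-\tfrac1\tau,\tfrac z\tau)&=e^{\pi iz^2/\tau}\{\tau h_1-\tfrac12\tau\vartheta_{01}\}+(-i\tau)^{1/2}e^{\frac{\pi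 i}\tau(z^2+\frac14)}\vartheta_{01},\\ g_2(-\tfrac1\tau,\tfrac z\tau)&=e^{\pi iz^2/\tau}\{i\tau h_2-\tfrac12\tau\vartheta_{11}\}+(-i\tau)^{1/2}e^{\frac{\pi i}\tau(z^2+\frac14)}\vartheta_{11},\\ g_3(-\tfrac1\tau,\tfrac z\tau)&=e^{\pi iz^2/\tau}\{\tau h_3-\tfrac12\tau\vartheta_{00}\}+(-i\tau)^{1/2}e^{\frac{\pi i}\tau(z^2+\frac14)}\vartheta_{00},\\ g_4(-\tfrac1\tau,\tfrac z\tau)&=e^{\pi iz^2/\tau}\{\tau h_4-\tfrac12\tau\vartheta_{10}\}+(-i\tau)^{1/2}e^{\frac{\pi i}\tau(z^2+\frac14)}\vartheta_{10},\\ h_1(-\tfrac1\tau,\tfrac z\tau)&=e^{\pi iz^2/\tau}\{\tau g_1-\tau q^{-\frac18}\vartheta_{10}+\tfrac12(-i\tau)^{1/2}\vartheta_{10}\},\\ h_2(-\tfrac1\tau,\tfrac z\tau)&=e^{\pi iz^2/\tau}\{i\tau g_2+\tau q^{-\frac18}\vartheta_{11}-\tfrac12(-i\tau)^{1/2}\vartheta_{11}\},\\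 h_3(-\tfrac1\tau,\tfrac z\tau)&=e^{\pi iz^2/\tau}\{\tau g_3-\tau q^{-\frac18}\vartheta_{00}+\tfrac12(-i\tau)^{1/2}\vartheta_{00}\},\\ h_4(-\tfrac1\tau,\tfrac z\tau)&=e^{\pi iz^2/\tau}\{\tau g_4-\tau q^{-\frac18}\vartheta_{01}+\tfrac12(-i\tau)^{1/2}\vartheta_{01}\}. \end{aligned}$$ 2) $T$-transformation: $$\begin{aligned} &f_1(\tau+1,z)=h_1,&&f_2(\tau+1,z)=e^{\pi i/4}h_2,&&f_3(\tau+1,z)=h_3,&&f_4(\tau+1,z)=e^{\pi i/4}h_4,\\ &g_1(\tau+1,z)=g_1,&&g_2(\tau+1,z)=g_2,&&g_3(\tau+1,z)=e^{-\pi i/4}g_4,&&g_4(\tau+1,z)=e^{-\pi i/4}g_3,\\ &h_1(\tau+1,z)=f_1,&&h_2(\tau+1,z)=e^{\pi i/4}f_2,&&h_3(\tau+1,z)=f_3,&&h_4(\tau+1,z)=e^{\pi i/4}f_4. \end{aligned}$$ -/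

import Mathlib

open Complex
open scoped Real

noncomputable section

namespace AppellSum

/-- The power `q ^ s` of the nome `q = exp (2 π i τ)`, that is `exp (2 π i s τ)`. -/
def qPow (τ s : ℂ) : ℂ := exp (2 * π * I * s * τ)

/-- Mumford's theta function `ϑ₀₀(τ, z) = ∑_{n ∈ ℤ} exp (π i n² τ + 2 π i n z)`. -/
def theta00 (τ z : ℂ) : ℂ := jacobiTheta₂ z τ

/-- `ϑ₀₁(τ, z) = ∑_{n ∈ ℤ} exp (π i n² τ + 2 π i n (z + 1/2))`. -/
def theta01 (τ z : ℂ) : ℂ := jacobiTheta₂ (z + 1 / 2) τ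

/-- `ϑ₁₀(τ, z) = ∑_{n ∈ ℤ} exp (π i (n + 1/2)² τ + 2 π i (n + 1/2) z)`. -/
def theta10 (τ z : ℂ) : ℂ := exp (π * I * τ / 4 + π * I * z) * jacobiTheta₂ (z + τ / 2) τ

/-- `ϑ₁₁(τ, z) = ∑_{n ∈ ℤ} exp (π i (n + 1/2)² τ + 2 π i (n + 1/2) (z + 1/2))`. -/
def theta11 (τ z : ℂ) : ℂ :=
  exp (π * I * τ / 4 + π * I * (z + 1 / 2)) * jacobiTheta₂ (z + (1 + τ) / 2) τ

/-- `w` is not a point of the lattice `ℤ τ + ℤ`. -/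
def OffLattice (τ w : ℂ) : Prop := ∀ m n : ℤ, w ≠ m * τ + n

def f1 (τ z : ℂ) : ℂ :=
  ∑' j : ℤ, (exp (2 * π * I * j * z) * qPow τ ((j : ℂ) ^ 2 / 2)) /
    (1 - exp (2 * π * I * z) * qPow τ j)

def f2 (τ z : ℂ) : ℂ :=
  ∑' j : ℤ, (-1 : ℂ) ^ j * (exp (2 * π * I * (j + 1 / 2) * z) * qPow τ (((j : ℂ) + 1 / 2) ^ 2 / 2)) /
    (1 + exp (2 * π * I * z) * qPow τ (j + 1 / 2))

def f3 (τ z : ℂ) : ℂ :=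
  ∑' j : ℤ, (-1 : ℂ) ^ j * (exp (2 * π * I * j * z) * qPow τ ((j : ℂ) ^ 2 / 2)) /
    (1 + exp (2 * π * I * z) * qPow τ j)

def f4 (τ z : ℂ) : ℂ :=
  ∑' j : ℤ, (exp (2 * π * I * (j + 1 / 2) * z) * qPow τ (((j : ℂ) + 1 / 2) ^ 2 / 2)) /
    (1 - exp (2 * π * I * z) * qPow τ (j + 1 / 2))

def g1 (τ z : ℂ) : ℂ :=
  ∑' j : ℤ, (exp (2 * π * I * (j - 1 / 2) * z) * qPow τ ((j : ℂ) * (j - 1) / 2)) /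
    (1 - exp (2 * π * I * z) * qPow τ j)

def g2 (τ z : ℂ) : ℂ :=
  ∑' j : ℤ, (-1 : ℂ) ^ j * (exp (2 * π * I * (j - 1 / 2) * z) * qPow τ ((j : ℂ) * (j - 1) / 2)) /
    (1 + exp (2 * π * I * z) * qPow τ j)

def g3 (τ z : ℂ) : ℂ :=
  ∑' j : ℤ, (exp (2 * π * I * j * z) * qPow τ (((j : ℂ) ^ 2 - 1 / 4) / 2)) /
    (1 - exp (2 * π * I * z) * qPow τ (j + 1 / 2))

def g4 (τ z : ℂ) : ℂ :=
  ∑' j : ℤ, (-1 : ℂ) ^ j * (exp (2 * π * I * j * z) * qPow τ (((j : ℂ) ^ 2 - 1 / 4) / 2)) /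
    (1 + exp (2 * π * I * z) * qPow τ (j + 1 / 2))

def h1 (τ z : ℂ) : ℂ :=
  ∑' j : ℤ, (-1 : ℂ) ^ j * (exp (2 * π * I * j * z) * qPow τ ((j : ℂ) ^ 2 / 2)) /
    (1 - exp (2 * π * I * z) * qPow τ j)

def h2 (τ z : ℂ) : ℂ :=
  ∑' j : ℤ, (-1 : ℂ) ^ j * (exp (2 * π * I * (j + 1 / 2) * z) * qPow τ (((j : ℂ) + 1 / 2) ^ 2 / 2)) /
    (1 - exp (2 * π * I * z) * qPow τ (j + 1 / 2))

def h3 (τ z : ℂ) : ℂ :=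
  ∑' j : ℤ, (exp (2 * π * I * j * z) * qPow τ ((j : ℂ) ^ 2 / 2)) /
    (1 + exp (2 * π * I * z) * qPow τ j)

def h4 (τ z : ℂ) : ℂ :=
  ∑' j : ℤ, (exp (2 * π * I * (j + 1 / 2) * z) * qPow τ (((j : ℂ) + 1 / 2) ^ 2 / 2)) /
    (1 + exp (2 * π * I * z) * qPow τ (j + 1 / 2))

end AppellSum

end

open AppellSum

/-!
For the inversion `S`, multiply the difference of the two sides by the Gaussian factor which makes
it quasi-periodic of degree one for the lattice `ℤ τ + ℤ`. The simple poles cancel, so it extends to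
an entire function, and such a function is determined by a single Fourier coefficient. The theta
correction is the one for which the difference is odd about a half-period; oddness kills that
coefficient, and the difference vanishes. This is needed for three shifts of the numerator only,
which account for the `f`, `g` and `h`; within each family the four sums differ by characteristics,
which the inversion permutes by `(a, b) ↦ (b, -a)`.

For the translation `T`, `j² ≡ j (mod 2)` turns `τ ↦ τ + 1` into a change of characteristics.
-/

namespace AppellSum

open Filter Topology

/-- The normalized exponential `e(x) = exp (2 π i x)`. -/
local notation "e(" x ")" => exp (2 * π * I * x)

theorem exp_two_pi_I_mul_add_int (w : ℂ) (n : ℤ) : e(w + n) = e(w) := by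
  rw [show 2 * π * I * (w + n) = 2 * π * I * w + n * (2 * π * I) by ring, exp_add,
    exp_int_mul_two_pi_mul_I, mul_one]

theorem exp_two_pi_I_mul_add_one (w : ℂ) : e(w + 1) = e(w) := by
  simpa using exp_two_pi_I_mul_add_int w 1

section QuasiPeriodic

theorem integral_shift_of_periodic {P : ℂ → ℂ} (hP : Differentiable ℂ P)
    (hper : ∀ z, P (z + 1) = P z) (w : ℂ) :
    ∫ x in (0 : ℝ)..1, P (x + w) = ∫ x in (0 : ℝ)..1, P x := by
  obtain ⟨Q, hQ⟩ := hP.isExactOn_univ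
  replace hQ : ∀ z, HasDerivAt Q (P z) z := fun z => hQ z (Set.mem_univ z)
  have integral_eq (v : ℂ) : ∫ x in (0 : ℝ)..1, P (x + v) = Q (1 + v) - Q v := by
    have hQv (x : ℝ) : HasDerivAt (fun x : ℝ => Q (x + v)) (P (x + v)) x :=
      ((hQ (x + v)).comp_add_const (x : ℂ) v).comp_ofReal
    have hPv : Continuous fun x : ℝ => P (x + v) := by
      have := hP.continuous
      fun_prop
    simpa using intervalIntegral.integral_eq_sub_of_hasDerivAt (fun x _ => hQv x)
      (hPv.intervalIntegrable 0 1)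
  have hderiv (v : ℂ) : HasDerivAt (fun v => Q (1 + v) - Q v) 0 v := by
    have hdiff := ((hQ (1 + v)).comp_const_add 1 v).sub (hQ v)
    rwa [add_comm 1 v, hper, sub_self] at hdiff
  have hconst := is_const_of_deriv_eq_zero (fun v => (hderiv v).differentiableAt)
    (fun v => (hderiv v).deriv) w 0
  rw [integral_eq, hconst, ← integral_eq]
  simp only [add_zero]

theorem eq_zero_of_fourier_integral_eq_zero {F : ℝ → ℂ} (hF : Continuous F)
    (hper : Function.Periodic F 1)
    (hcoeff : ∀ n : ℤ, ∫ x in (0 : ℝ)..1, e(-(n * x)) * F x = 0) : F = 0 := by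
  have : Fact ((0 : ℝ) < 1) := ⟨one_pos⟩
  let G : C(AddCircle (1 : ℝ), ℂ) := ⟨hper.lift, hF.quotient_liftOn' _⟩
  have hG (x : ℝ) : G x = F x := hper.lift_coe x
  have fourierCoeff_eq_zero : fourierCoeff G = 0 := by
    funext n
    rw [fourierCoeff_eq_intervalIntegral G n 0, zero_add, div_one, one_smul, Pi.zero_apply,
      ← hcoeff n]
    refine intervalIntegral.integral_congr fun x _ => ?_
    simp only [fourier_coe_apply, smul_eq_mul, hG]
    congr 2
    push_cast
    ring
  funext x
  have hsum := has_pointwise_sum_fourier_series_of_summable (f := G)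
    (by rw [fourierCoeff_eq_zero]; exact summable_zero) (x : AddCircle (1 : ℝ))
  simp only [fourierCoeff_eq_zero, Pi.zero_apply, zero_smul] at hsum
  rw [← hG, hsum.unique hasSum_zero, Pi.zero_apply]

theorem eq_zero_of_forall_ofReal_eq_zero {N : ℂ → ℂ} (hN : Differentiable ℂ N)
    (hreal : ∀ x : ℝ, N x = 0) : N = 0 := by
  have hofReal : Tendsto ((↑) : ℝ → ℂ) (𝓝[≠] 0) (𝓝[≠] ((0 : ℝ) : ℂ)) :=
    continuous_ofReal.continuousWithinAt.tendsto_nhdsWithin fun x hx => by simpa using hx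
  exact AnalyticOnNhd.eq_of_frequently_eq (fun z _ => hN.analyticAt z)
    (fun z _ => analyticAt_const) (hofReal.frequently (Eventually.of_forall hreal).frequently)

theorem eq_zero_of_periodic_of_fourier_integral_eq_zero {N : ℂ → ℂ} (hN : Differentiable ℂ N)
    (hper : ∀ z, N (z + 1) = N z)
    (hcoeff : ∀ n : ℤ, ∫ x in (0 : ℝ)..1, e(-(n * x)) * N x = 0) : N = 0 := by
  have hreal : (fun x : ℝ => N x) = 0 :=
    eq_zero_of_fourier_integral_eq_zero (hN.continuous.comp continuous_ofReal)
      (fun x => by push_cast; exact hper x) hcoeff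
  exact eq_zero_of_forall_ofReal_eq_zero hN fun x => congrFun hreal x

/-- `N` is quasi-periodic of degree one, with multiplier `k`, for the lattice `ℤ τ + ℤ`: it
transforms as `z ↦ ϑ₀₀(τ, z + c)` does for a suitable `c`. -/
structure IsThetaType (τ k : ℂ) (N : ℂ → ℂ) : Prop where
  add_one : ∀ z, N (z + 1) = N z
  add_tau : ∀ z, N (z + τ) = k * e(-z) * N z

namespace IsThetaType

variable {τ k : ℂ} {N : ℂ → ℂ}

theorem fourier_integral_succ (h : IsThetaType τ k N) (hN : Differentiable ℂ N) (n : ℤ) :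
    ∫ x in (0 : ℝ)..1, e(-(n * x)) * N x =
      k * e(-(n * τ)) * ∫ x in (0 : ℝ)..1, e(-((n + 1 : ℤ) * x)) * N x := by
  have hshift := integral_shift_of_periodic (P := fun z => e(-(n * z)) * N z) (by fun_prop)
    (fun z => by
      rw [h.add_one, ← exp_two_pi_I_mul_add_int (-(n * z)) (-n)]
      push_cast
      ring_nf) τ
  rw [← hshift, ← intervalIntegral.integral_const_mul]
  refine intervalIntegral.integral_congr fun x _ => ?_
  have hexp : e(-(n * (x + τ))) * e(-(x : ℂ)) = e(-(n * τ)) * e(-((n + 1 : ℤ) * x)) := by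
    rw [← exp_add, ← exp_add]
    push_cast
    ring_nf
  simp only [h.add_tau]
  linear_combination k * N x * hexp

theorem eq_zero_of_integral_eq_zero (h : IsThetaType τ k N) (hN : Differentiable ℂ N) (hk : k ≠ 0)
    (hint : ∫ x in (0 : ℝ)..1, N x = 0) : N = 0 := by
  refine eq_zero_of_periodic_of_fourier_integral_eq_zero hN h.add_one fun n => ?_
  induction n using Int.induction_on with
  | zero => simpa using hint
  | succ n ih =>
    rw [h.fourier_integral_succ hN] at ih
    simpa [hk, exp_ne_zero] using ih
  | pred n ih => rw [h.fourier_integral_succ hN, sub_add_cancel, ih, mul_zero]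

theorem eq_zero_of_odd (h : IsThetaType τ k N) (hN : Differentiable ℂ N) (hk : k ≠ 0) (s : ℂ)
    (hodd : ∀ z, N (s - z) = -N z) : N = 0 := by
  refine h.eq_zero_of_integral_eq_zero hN hk ?_
  have hreflect := intervalIntegral.integral_comp_sub_left (a := 0) (b := 1)
    (fun x : ℝ => N (x + (s - 1))) 1
  have hshift := integral_shift_of_periodic hN h.add_one (s - 1)
  simp only [ofReal_sub, ofReal_one, sub_add_sub_cancel', sub_self, sub_zero, hshift] at hreflect
  simp only [hodd, intervalIntegral.integral_neg] at hreflect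
  linear_combination -hreflect / 2

end IsThetaType

end QuasiPeriodic

section RemovableSingularities

theorem meromorphicOrderAt_nonneg_of_tendsto_sub_mul {D : ℂ → ℂ} {p : ℂ} (hD : MeromorphicAt D p)
    (hlim : Tendsto (fun z => (z - p) * D z) (𝓝[≠] p) (𝓝 0)) : 0 ≤ meromorphicOrderAt D p := by
  have hsub : MeromorphicAt (fun z => z - p) p := by fun_prop
  have hpos : 0 < meromorphicOrderAt ((fun z => z - p) * D) p :=
    (tendsto_zero_iff_meromorphicOrderAt_pos (hsub.mul hD)).1 hlim
  rw [meromorphicOrderAt_mul hsub hD, meromorphicOrderAt_id_sub_const] at hpos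
  cases horder : meromorphicOrderAt D p with
  | top => exact le_top
  | coe n =>
    rw [horder] at hpos
    norm_cast at hpos ⊢
    lia

theorem exists_differentiable_eq_of_tendsto_sub_mul {D : ℂ → ℂ} (hD : Meromorphic D)
    (hlim : ∀ p, Tendsto (fun z => (z - p) * D z) (𝓝[≠] p) (𝓝 0)) :
    ∃ N : ℂ → ℂ, Differentiable ℂ N ∧ ∀ p, AnalyticAt ℂ D p → N p = D p := by
  have hD' : MeromorphicOn D Set.univ := meromorphicOn_univ.2 hD
  have N_eq (p : ℂ) : toMeromorphicNFOn D Set.univ p = toMeromorphicNFAt D p p :=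
    toMeromorphicNFOn_eq_toMeromorphicNFAt hD' (Set.mem_univ p)
  refine ⟨toMeromorphicNFOn D Set.univ, fun p => AnalyticAt.differentiableAt ?_, fun p hp => ?_⟩
  · rw [← (meromorphicNFOn_toMeromorphicNFOn D _
      (Set.mem_univ p)).meromorphicOrderAt_nonneg_iff_analyticAt,
      meromorphicOrderAt_toMeromorphicNFOn hD' (Set.mem_univ p)]
    exact meromorphicOrderAt_nonneg_of_tendsto_sub_mul (hD p) (hlim p)
  · rw [N_eq, toMeromorphicNFAt_eq_self.2 hp.meromorphicNFAt]

theorem tendsto_sub_mul_of_translate {D u : ℂ → ℂ} (hu : Continuous u) {p : ℂ}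
    (htrans : ∀ z, D (z + p) = u z * D z) (hlim : Tendsto (fun z => z * D z) (𝓝[≠] 0) (𝓝 0)) :
    Tendsto (fun z => (z - p) * D z) (𝓝[≠] p) (𝓝 0) := by
  have hprod : Tendsto (fun z => u z * (z * D z)) (𝓝[≠] 0) (𝓝 (u 0 * 0)) :=
    (hu.continuousAt.tendsto.mono_left nhdsWithin_le_nhds).mul hlim
  have hsub : Tendsto (fun z => z - p) (𝓝[≠] p) (𝓝[≠] 0) := by
    have hmaps : Set.MapsTo (fun z => z - p) {p}ᶜ {p - p}ᶜ := fun z hz => by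
      simpa [sub_eq_zero] using hz
    have hcont : ContinuousWithinAt (fun z => z - p) {p}ᶜ p := by fun_prop
    simpa using hcont.tendsto_nhdsWithin hmaps
  rw [mul_zero] at hprod
  refine (hprod.comp hsub).congr fun z => ?_
  have hz := htrans (z - p)
  rw [sub_add_cancel] at hz
  simp only [Function.comp_apply]
  linear_combination -(z - p) * hz

end RemovableSingularities

section Lattice

theorem dense_offLattice (τ : ℂ) : Dense {z | OffLattice τ z} := by
  have hcountable : (Set.range fun p : ℤ × ℤ => (p.1 * τ + p.2 : ℂ)).Countable :=
    Set.countable_range _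
  refine (hcountable.dense_compl ℂ).mono ?_
  exact fun z hz m n h => hz ⟨(m, n), h.symm⟩

theorem OffLattice.neg {τ z : ℂ} (h : OffLattice τ z) : OffLattice τ (-z) := fun m n hmn =>
  h (-m) (-n) (by push_cast; linear_combination -hmn)

theorem OffLattice.add_lattice {τ z : ℂ} (h : OffLattice τ z) (m n : ℤ) :
    OffLattice τ (z + (m * τ + n)) := fun a b hab =>
  h (a - m) (b - n) (by push_cast; linear_combination hab)

namespace IsThetaType

variable {τ k : ℂ} {D : ℂ → ℂ}

theorem exists_add_int_mul_tau (h : IsThetaType τ k D) (hk : k ≠ 0) (m : ℤ) :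
    ∃ u : ℂ → ℂ, Continuous u ∧ ∀ z, D (z + m * τ) = u z * D z := by
  induction m using Int.induction_on with
  | zero => exact ⟨1, continuous_one, fun z => by simp⟩
  | succ m ih =>
    obtain ⟨u, hu, hDu⟩ := ih
    refine ⟨fun z => k * e(-(z + m * τ)) * u z, by fun_prop, fun z => ?_⟩
    have hstep := h.add_tau (z + m * τ)
    push_cast at hDu ⊢
    rw [hDu] at hstep
    rw [add_one_mul, ← add_assoc, hstep, mul_assoc _ (u z)]
  | pred m ih =>
    obtain ⟨u, hu, hDu⟩ := ih
    refine ⟨fun z => k⁻¹ * e(z - (m + 1) * τ) * u z, by fun_prop, fun z => ?_⟩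
    have hstep := h.add_tau (z - (m + 1) * τ)
    have hcancel : e(z - (m + 1) * τ) * e(-(z - (m + 1) * τ)) = 1 := by
      rw [← exp_add, mul_neg, add_neg_cancel, exp_zero]
    push_cast at hDu ⊢
    rw [show z - (m + 1) * τ + τ = z + -m * τ by ring, hDu] at hstep
    rw [mul_assoc _ (u z), hstep, show z + (-m - 1) * τ = z - (m + 1) * τ by ring]
    linear_combination -(D (z - (m + 1) * τ)) * (hcancel + e(z - (m + 1) * τ) *
      e(-(z - (m + 1) * τ)) * inv_mul_cancel₀ hk)

theorem add_int (h : IsThetaType τ k D) (z : ℂ) (n : ℤ) : D (z + n) = D z := by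
  have hper : Function.Periodic D 1 := h.add_one
  simpa using hper.int_mul n z

theorem tendsto_sub_lattice_mul (h : IsThetaType τ k D) (hk : k ≠ 0)
    (hlim : Tendsto (fun z => z * D z) (𝓝[≠] 0) (𝓝 0)) (m n : ℤ) :
    Tendsto (fun z => (z - (m * τ + n)) * D z) (𝓝[≠] (m * τ + n)) (𝓝 0) := by
  obtain ⟨u, hu, hDu⟩ := h.exists_add_int_mul_tau hk m
  exact tendsto_sub_mul_of_translate hu (fun z => by rw [← add_assoc, h.add_int, hDu]) hlim

theorem of_dense {N : ℂ → ℂ} (h : IsThetaType τ k D) (hN : Continuous N)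
    (hND : ∀ z, OffLattice τ z → N z = D z) : IsThetaType τ k N where
  add_one := congrFun <| (Continuous.ext_on (dense_offLattice τ) (by fun_prop) hN) fun z hz => by
    have hz1 : OffLattice τ (z + 1) := by simpa using hz.add_lattice 0 1
    rw [hND _ hz1, hND _ hz, h.add_one]
  add_tau := congrFun <| (Continuous.ext_on (dense_offLattice τ) (by fun_prop) (by fun_prop))
    fun z hz => by
      have hzτ : OffLattice τ (z + τ) := by simpa using hz.add_lattice 1 0
      simp only [hND _ hzτ, hND _ hz, h.add_tau]

theorem eq_zero_of_odd_off_lattice (h : IsThetaType τ k D) (hk : k ≠ 0) (hmero : Meromorphic D)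
    (han : ∀ z, OffLattice τ z → AnalyticAt ℂ D z)
    (hlim : Tendsto (fun z => z * D z) (𝓝[≠] 0) (𝓝 0)) (m n : ℤ)
    (hodd : ∀ z, OffLattice τ z → D (m * τ + n - z) = -D z) {z : ℂ} (hz : OffLattice τ z) :
    D z = 0 := by
  have removable (p : ℂ) : Tendsto (fun z => (z - p) * D z) (𝓝[≠] p) (𝓝 0) := by
    by_cases hp : OffLattice τ p
    · have hcont : ContinuousAt (fun z => (z - p) * D z) p :=
        (by fun_prop : ContinuousAt (fun z => z - p) p).mul (han p hp).continuousAt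
      simpa using hcont.tendsto.mono_left nhdsWithin_le_nhds
    · simp only [OffLattice, not_forall, not_not] at hp
      obtain ⟨a, b, rfl⟩ := hp
      exact h.tendsto_sub_lattice_mul hk hlim a b
  obtain ⟨N, hN, hND⟩ := exists_differentiable_eq_of_tendsto_sub_mul hmero removable
  replace hND (w : ℂ) (hw : OffLattice τ w) : N w = D w := hND w (han w hw)
  have hNcont := hN.continuous
  have hNodd : (fun w => N (m * τ + n - w)) = fun w => -N w := by
    refine Continuous.ext_on (dense_offLattice τ) (by fun_prop) (by fun_prop) fun w hw => ?_
    have hreflect : OffLattice τ (m * τ + n - w) := by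
      simpa [neg_add_eq_sub] using hw.neg.add_lattice m n
    simp only [hND _ hreflect, hND _ hw, hodd w hw]
  have hN0 := (h.of_dense hNcont hND).eq_zero_of_odd hN hk _ (congrFun hNodd)
  rw [← hND z hz, hN0, Pi.zero_apply]

end IsThetaType

end Lattice

section LerchSum

/-- The summand `e(j (z + c)) q^{j² / 2} / (1 - e(z) q^j)` of `lerchSum`. -/
noncomputable def lerchTerm (τ c z : ℂ) (j : ℤ) : ℂ :=
  jacobiTheta₂_term j (z + c) τ / (1 - e(z + j * τ))

/-- The level-one Appell–Lerch sum, normalized as `f₁` and with the variable of the numerator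
shifted by `c`. -/
noncomputable def lerchSum (τ c z : ℂ) : ℂ := ∑' j : ℤ, lerchTerm τ c z j

variable {τ : ℂ}

theorem one_sub_exp_eq_zero_iff {w : ℂ} : 1 - e(w) = 0 ↔ ∃ n : ℤ, w = n := by
  rw [sub_eq_zero, eq_comm, exp_eq_one_iff]
  refine exists_congr fun n => ?_
  rw [mul_comm (n : ℂ), mul_right_inj' two_pi_I_ne_zero]

theorem OffLattice.one_sub_exp_ne_zero {z : ℂ} (h : OffLattice τ z) (j : ℤ) :
    1 - e(z + j * τ) ≠ 0 := fun hzero => by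
  obtain ⟨n, hn⟩ := one_sub_exp_eq_zero_iff.1 hzero
  exact h (-j) n (by push_cast; linear_combination hn)

theorem one_sub_exp_int_mul_ne_zero (hτ : 0 < τ.im) {j : ℤ} (hj : j ≠ 0) : 1 - e(j * τ) ≠ 0 := by
  rw [Ne, one_sub_exp_eq_zero_iff]
  rintro ⟨n, hn⟩
  have him := congrArg im hn
  simp [hτ.ne', hj] at him

theorem half_le_norm_one_sub_exp {w : ℂ} (hw : 1 ≤ |w.im|) : 1 / 2 ≤ ‖1 - e(w)‖ := by
  have hnorm : ‖e(w)‖ = Real.exp (-(2 * π * w.im)) := by simp [norm_exp]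
  have hpi := Real.pi_gt_three
  rcases le_abs.1 hw with him | him
  · have hsmall : ‖e(w)‖ ≤ 1 / 2 := by
      rw [hnorm, Real.exp_neg, one_div]
      exact inv_anti₀ two_pos (by nlinarith [Real.add_one_le_exp (2 * π * w.im)])
    have := norm_sub_norm_le 1 (e(w))
    rw [norm_one] at this
    linarith
  · have hlarge : 2 ≤ ‖e(w)‖ := by
      rw [hnorm]
      nlinarith [Real.add_one_le_exp (-(2 * π * w.im))]
    have := norm_sub_norm_le (e(w)) 1
    rw [norm_one, norm_sub_rev] at this
    linarith

theorem norm_lerchTerm_le {c z : ℂ} {j : ℤ} (hj : 1 ≤ |(z + j * τ).im|) :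
    ‖lerchTerm τ c z j‖ ≤ 2 * ‖jacobiTheta₂_term j (z + c) τ‖ := by
  have hden := half_le_norm_one_sub_exp hj
  rw [lerchTerm, norm_div, div_le_iff₀ (by linarith)]
  nlinarith [norm_nonneg (jacobiTheta₂_term j (z + c) τ)]

theorem abs_im_lt_of_mem_ball_one {p z : ℂ} (hz : z ∈ Metric.ball p 1) : |z.im| < |p.im| + 1 := by
  have hsub : |z.im - p.im| < 1 :=
    (abs_im_le_norm (z - p)).trans_lt (mem_ball_iff_norm.1 hz)
  linarith [abs_sub_abs_le_abs_sub z.im p.im]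

theorem one_le_abs_im_add_int_mul (hτ : 0 < τ.im) {p z : ℂ} (hz : z ∈ Metric.ball p 1) {j : ℤ}
    (hj : (|p.im| + 2) / τ.im ≤ |(j : ℝ)|) : 1 ≤ |(z + j * τ).im| := by
  rw [div_le_iff₀ hτ, ← abs_of_pos hτ, ← abs_mul] at hj
  have him := abs_im_lt_of_mem_ball_one hz
  have htriangle := abs_sub_abs_le_abs_sub (j * τ.im) (-z.im)
  rw [abs_neg, sub_neg_eq_add, add_comm] at htriangle
  simp only [add_im, mul_im, intCast_re, intCast_im, zero_mul, add_zero]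
  linarith

theorem exists_finset_norm_lerchTerm_le (hτ : 0 < τ.im) (c p : ℂ) :
    ∃ (s : Finset ℤ) (u : ℤ → ℝ), 0 ∈ s ∧ Summable u ∧ ∀ z ∈ Metric.ball p 1, ∀ j ∉ s,
      1 ≤ |(z + j * τ).im| ∧ ‖lerchTerm τ c z j‖ ≤ u j := by
  obtain ⟨J, hJ⟩ := exists_nat_ge ((|p.im| + 2) / τ.im)
  refine ⟨Finset.Icc (-J) J, _, by simp, (summable_pow_mul_jacobiTheta₂_term_bound
    (|p.im| + 1 + |c.im|) hτ 0).mul_left 2, fun z hz j hj => ?_⟩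
  have hjJ : (J : ℝ) ≤ |(j : ℝ)| := by
    rw [Finset.mem_Icc, ← abs_le, not_le] at hj
    exact_mod_cast hj.le
  have him := one_le_abs_im_add_int_mul hτ hz (hJ.trans hjJ)
  have hzc : |(z + c).im| ≤ |p.im| + 1 + |c.im| := by
    rw [add_im]
    linarith [abs_add_le z.im c.im, abs_im_lt_of_mem_ball_one hz]
  refine ⟨him, (norm_lerchTerm_le him).trans ?_⟩
  simpa using norm_jacobiTheta₂_term_le hτ hzc le_rfl j

theorem summable_lerchTerm (hτ : 0 < τ.im) (c z : ℂ) : Summable (lerchTerm τ c z) := by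
  obtain ⟨s, u, -, hu, hbound⟩ := exists_finset_norm_lerchTerm_le hτ c z
  rw [← s.summable_compl_iff]
  exact .of_norm_bounded (hu.subtype _) fun j =>
    (hbound z (Metric.mem_ball_self one_pos) j j.2).2

theorem differentiable_jacobiTheta₂_term_fst (j : ℤ) (τ : ℂ) :
    Differentiable ℂ fun z => jacobiTheta₂_term j z τ := by
  unfold jacobiTheta₂_term
  fun_prop

theorem analyticAt_jacobiTheta₂_term_add (j : ℤ) (τ c p : ℂ) :
    AnalyticAt ℂ (fun z => jacobiTheta₂_term j (z + c) τ) p :=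
  ((differentiable_jacobiTheta₂_term_fst j τ).comp
    (differentiable_id.add_const c)).analyticAt p

theorem analyticAt_one_sub_exp (w p : ℂ) : AnalyticAt ℂ (fun z => 1 - e(z + w)) p := by
  fun_prop

theorem analyticAt_lerchTerm {c p : ℂ} {j : ℤ} (h : 1 - e(p + j * τ) ≠ 0) :
    AnalyticAt ℂ (fun z => lerchTerm τ c z j) p :=
  (analyticAt_jacobiTheta₂_term_add j τ c p).div (analyticAt_one_sub_exp _ p) h

theorem meromorphicAt_lerchTerm (τ c p : ℂ) (j : ℤ) :
    MeromorphicAt (fun z => lerchTerm τ c z j) p :=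
  (analyticAt_jacobiTheta₂_term_add j τ c p).meromorphicAt.div
    (analyticAt_one_sub_exp _ p).meromorphicAt

theorem exists_lerchSum_eventuallyEq_sum_add (hτ : 0 < τ.im) (c p : ℂ) :
    ∃ (s : Finset ℤ) (R : ℂ → ℂ), 0 ∈ s ∧ AnalyticAt ℂ R p ∧
      lerchSum τ c =ᶠ[𝓝 p] fun z => ∑ j ∈ s, lerchTerm τ c z j + R z := by
  obtain ⟨s, u, hs, hu, hbound⟩ := exists_finset_norm_lerchTerm_le hτ c p
  refine ⟨s, fun z => ∑' j : {j // j ∉ s}, lerchTerm τ c z j, hs, ?_, .of_forall fun z =>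
    ((summable_lerchTerm hτ c z).sum_add_tsum_subtype_compl s).symm⟩
  have hball : Metric.ball p 1 ∈ 𝓝 p := Metric.ball_mem_nhds p one_pos
  refine (differentiableOn_tsum_of_summable_norm (hu.subtype _) (fun j z hz => ?_)
    Metric.isOpen_ball fun j z hz => (hbound z hz j j.2).2).analyticAt hball
  have hden := half_le_norm_one_sub_exp (hbound z hz j j.2).1
  have hne : 1 - e(z + (j : ℤ) * τ) ≠ 0 := norm_pos_iff.1 (by linarith)
  exact (analyticAt_lerchTerm hne).differentiableAt.differentiableWithinAt

theorem analyticAt_lerchSum (hτ : 0 < τ.im) (c : ℂ) {z : ℂ} (hz : OffLattice τ z) :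
    AnalyticAt ℂ (lerchSum τ c) z := by
  obtain ⟨s, R, -, hR, hlocal⟩ := exists_lerchSum_eventuallyEq_sum_add hτ c z
  exact ((Finset.analyticAt_fun_sum s fun j _ =>
    analyticAt_lerchTerm (hz.one_sub_exp_ne_zero j)).add hR).congr hlocal.symm

theorem meromorphic_lerchSum (hτ : 0 < τ.im) (c : ℂ) : Meromorphic (lerchSum τ c) := fun p => by
  obtain ⟨s, R, -, hR, hlocal⟩ := exists_lerchSum_eventuallyEq_sum_add hτ c p
  exact ((MeromorphicAt.fun_sum fun j _ => meromorphicAt_lerchTerm τ c p j).add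
    hR.meromorphicAt).congr (hlocal.symm.filter_mono nhdsWithin_le_nhds)

theorem tendsto_mul_lerchTerm_zero (τ c : ℂ) :
    Tendsto (fun z => z * lerchTerm τ c z 0) (𝓝[≠] 0) (𝓝 (-(2 * π * I)⁻¹)) := by
  have hderiv : HasDerivAt (fun z : ℂ => 1 - e(z)) (-(2 * π * I)) 0 := by
    simpa using ((hasDerivAt_id (0 : ℂ)).const_mul (2 * π * I)).cexp.const_sub 1
  have hslope := hderiv.tendsto_slope_zero.inv₀ (neg_ne_zero.2 two_pi_I_ne_zero)
  rw [inv_neg] at hslope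
  refine hslope.congr fun z => ?_
  simp [lerchTerm, jacobiTheta₂_term, div_eq_mul_inv, mul_comm]

theorem tendsto_mul_lerchSum (hτ : 0 < τ.im) (c : ℂ) :
    Tendsto (fun z => z * lerchSum τ c z) (𝓝[≠] 0) (𝓝 (-(2 * π * I)⁻¹)) := by
  obtain ⟨s, R, hs, hR, hlocal⟩ := exists_lerchSum_eventuallyEq_sum_add hτ c 0
  have hregular : AnalyticAt ℂ (fun z => ∑ j ∈ s.erase 0, lerchTerm τ c z j + R z) 0 :=
    (Finset.analyticAt_fun_sum _ fun j hj => analyticAt_lerchTerm (by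
      simpa using one_sub_exp_int_mul_ne_zero hτ (Finset.ne_of_mem_erase hj))).add hR
  have hvanish : Tendsto (fun z => z * (∑ j ∈ s.erase 0, lerchTerm τ c z j + R z)) (𝓝[≠] 0)
      (𝓝 0) := by
    have hcont : ContinuousAt (fun z => z * (∑ j ∈ s.erase 0, lerchTerm τ c z j + R z)) 0 :=
      continuousAt_id.mul hregular.continuousAt
    simpa using hcont.tendsto.mono_left nhdsWithin_le_nhds
  rw [← add_zero (-(2 * π * I)⁻¹)]
  refine ((tendsto_mul_lerchTerm_zero τ c).add hvanish).congr' ?_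
  filter_upwards [hlocal.filter_mono nhdsWithin_le_nhds] with z hz
  rw [hz, ← Finset.add_sum_erase s _ hs]
  ring

theorem jacobiTheta₂_term_add_one_fst (j : ℤ) (z τ : ℂ) :
    jacobiTheta₂_term j (z + 1) τ = jacobiTheta₂_term j z τ := by
  rw [jacobiTheta₂_term, mul_add_one, add_right_comm, exp_add, mul_comm (2 * π * I) (j : ℂ),
    exp_int_mul_two_pi_mul_I, mul_one, mul_comm (j : ℂ), jacobiTheta₂_term]

theorem jacobiTheta₂_term_add_tau (j : ℤ) (z τ : ℂ) :
    jacobiTheta₂_term j (z + τ) τ = e(j * τ) * jacobiTheta₂_term j z τ := by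
  rw [jacobiTheta₂_term, jacobiTheta₂_term, ← exp_add]
  ring_nf

theorem jacobiTheta₂_term_add_one_left (j : ℤ) (z τ : ℂ) :
    jacobiTheta₂_term (j + 1) z τ = e(z + τ / 2) * jacobiTheta₂_term j (z + τ) τ := by
  rw [jacobiTheta₂_term, jacobiTheta₂_term, ← exp_add]
  push_cast
  ring_nf

theorem jacobiTheta₂_term_neg_left (j : ℤ) (z τ : ℂ) :
    jacobiTheta₂_term (-j) z τ = jacobiTheta₂_term j (-z) τ := by
  rw [jacobiTheta₂_term, jacobiTheta₂_term]
  push_cast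
  ring_nf

theorem lerchSum_add_one (τ c z : ℂ) : lerchSum τ c (z + 1) = lerchSum τ c z := by
  refine tsum_congr fun j => ?_
  rw [lerchTerm, lerchTerm, add_right_comm z 1, jacobiTheta₂_term_add_one_fst, add_right_comm z 1,
    exp_two_pi_I_mul_add_one]

theorem lerchSum_add_one_numerator (τ c z : ℂ) : lerchSum τ (c + 1) z = lerchSum τ c z := by
  refine tsum_congr fun j => ?_
  rw [lerchTerm, lerchTerm, ← add_assoc, jacobiTheta₂_term_add_one_fst]

theorem lerchSum_add_tau (τ c z : ℂ) :
    lerchSum τ c (z + τ) = e(-(z + c) - τ / 2) * lerchSum τ c z := by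
  rw [lerchSum, lerchSum, ← (Equiv.addRight (1 : ℤ)).tsum_eq (lerchTerm τ c z), ← tsum_mul_left]
  refine tsum_congr fun j => ?_
  have hcancel : e(-(z + c) - τ / 2) * e(z + c + τ / 2) = 1 := by
    rw [← exp_add, ← mul_add, ← exp_zero]
    ring_nf
  rw [Equiv.coe_addRight, lerchTerm, lerchTerm, jacobiTheta₂_term_add_one_left, ← mul_div_assoc,
    ← mul_assoc, hcancel, one_mul]
  push_cast
  ring_nf

theorem lerchSum_sub_tau (τ c z : ℂ) :
    lerchSum τ c (z - τ) = e(z + c - τ / 2) * lerchSum τ c z := by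
  have hcancel : e(z + c - τ / 2) * e(-(z - τ + c) - τ / 2) = 1 := by
    rw [← exp_add, ← mul_add, ← exp_zero]
    ring_nf
  have hadd := lerchSum_add_tau τ c (z - τ)
  rw [sub_add_cancel] at hadd
  rw [hadd, ← mul_assoc, hcancel, one_mul]

theorem lerchSum_neg (hτ : 0 < τ.im) (c : ℂ) {z : ℂ} (hz : OffLattice τ z) :
    lerchSum τ c (-z) = jacobiTheta₂ (z - c) τ - lerchSum τ (-c) z := by
  rw [lerchSum, lerchSum, jacobiTheta₂, ← (Equiv.neg ℤ).tsum_eq,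
    ← Summable.tsum_sub ((summable_jacobiTheta₂_term_iff _ _).2 hτ) (summable_lerchTerm hτ _ _)]
  refine tsum_congr fun j => ?_
  have hexp : e(-z + (-j : ℤ) * τ) = (e(z + j * τ))⁻¹ := by
    rw [← exp_neg]
    push_cast
    ring_nf
  rw [Equiv.neg_apply, lerchTerm, lerchTerm, jacobiTheta₂_term_neg_left, hexp, neg_add, neg_neg,
    ← sub_eq_add_neg]
  have hden := hz.one_sub_exp_ne_zero j
  have hden' : e(z + j * τ) - 1 ≠ 0 := fun h => hden (by linear_combination -h)
  have hne := exp_ne_zero (2 * π * I * (z + j * τ))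
  field_simp
  ring

theorem exp_mul_lerchSum_add_tau_numerator (hτ : 0 < τ.im) (c : ℂ) {z : ℂ}
    (hz : OffLattice τ z) :
    e(z) * lerchSum τ (c + τ) z = lerchSum τ c z - jacobiTheta₂ (z + c) τ := by
  rw [lerchSum, lerchSum, jacobiTheta₂, ← Summable.tsum_sub (summable_lerchTerm hτ _ _)
    ((summable_jacobiTheta₂_term_iff _ _).2 hτ), ← tsum_mul_left]
  refine tsum_congr fun j => ?_
  have hden := hz.one_sub_exp_ne_zero j
  rw [lerchTerm, lerchTerm, ← add_assoc, jacobiTheta₂_term_add_tau, mul_div_assoc', ← mul_assoc,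
    ← exp_add, ← mul_add, div_sub' hden]
  ring

end LerchSum

section Inversion

variable {τ : ℂ}

theorem ne_zero_of_im_pos (hτ : 0 < τ.im) : τ ≠ 0 := by
  rintro rfl
  simp at hτ

theorem im_neg_one_div_pos (hτ : 0 < τ.im) : 0 < (-1 / τ).im := by
  rw [neg_div, one_div, neg_im, inv_im, neg_div, neg_neg]
  exact div_pos hτ (normSq_pos.2 (ne_zero_of_im_pos hτ))

theorem OffLattice.inversion {z : ℂ} (h : OffLattice τ z) (h0 : τ ≠ 0) :
    OffLattice (-1 / τ) (z / τ) := fun m n hmn => by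
  field_simp at hmn
  exact h n (-m) (by push_cast; linear_combination hmn)

theorem jacobiTheta₂_inversion (h0 : τ ≠ 0) (z : ℂ) :
    jacobiTheta₂ (z / τ) (-1 / τ) =
      (-I * τ) ^ (1 / 2 : ℂ) * e(z ^ 2 / (2 * τ)) * jacobiTheta₂ z τ := by
  have hroot : (-I * τ) ^ (1 / 2 : ℂ) ≠ 0 := by simp [cpow_eq_zero_iff, h0]
  have hcancel : e(z ^ 2 / (2 * τ)) * exp (-π * I * z ^ 2 / τ) = 1 := by
    rw [← exp_add, ← exp_zero]
    ring_nf
  rw [jacobiTheta₂_functional_equation z τ]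
  linear_combination -jacobiTheta₂ (z / τ) (-1 / τ) *
    (hcancel + e(z ^ 2 / (2 * τ)) * exp (-π * I * z ^ 2 / τ) * mul_one_div_cancel hroot)

theorem jacobiTheta₂_add_tau (z τ : ℂ) :
    jacobiTheta₂ (z + τ) τ = e(-z - τ / 2) * jacobiTheta₂ z τ := by
  rw [jacobiTheta₂_add_left']
  ring_nf

theorem differentiable_jacobiTheta₂_fst (hτ : 0 < τ.im) :
    Differentiable ℂ fun z => jacobiTheta₂ z τ := fun z => differentiableAt_jacobiTheta₂_fst z hτ

/-- The defect of the modular inversion of `lerchSum τ c`, for the automorphy factor of weight one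
and a theta correction with coefficient `κ`. -/
noncomputable def inversionDefect (τ c κ z : ℂ) : ℂ :=
  e(-(z ^ 2 / (2 * τ)) - c * z / τ) * lerchSum (-1 / τ) (c / τ) (z / τ) - τ * lerchSum τ c z +
    κ * jacobiTheta₂ (z + c) τ

theorem isThetaType_inversionDefect (h0 : τ ≠ 0) (c κ : ℂ) :
    IsThetaType τ (e(-c - τ / 2)) (inversionDefect τ c κ) where
  add_one z := by
    have hexp : e(-((z + 1) ^ 2 / (2 * τ)) - c * (z + 1) / τ) * e(z / τ + c / τ - -1 / τ / 2) =
        e(-(z ^ 2 / (2 * τ)) - c * z / τ) := by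
      rw [← exp_add]
      ring_nf
    rw [inversionDefect, inversionDefect, show (z + 1) / τ = z / τ - -1 / τ by ring,
      lerchSum_sub_tau, lerchSum_add_one, add_right_comm, jacobiTheta₂_add_left, ← mul_assoc, hexp]
  add_tau z := by
    have hexp : e(-((z + τ) ^ 2 / (2 * τ)) - c * (z + τ) / τ) =
        e(-c - τ / 2) * e(-z) * e(-(z ^ 2 / (2 * τ)) - c * z / τ) := by
      rw [← exp_add, ← exp_add]
      field_simp
      ring_nf
    have hfactor : e(-(z + c) - τ / 2) = e(-c - τ / 2) * e(-z) := by
      rw [← exp_add]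
      ring_nf
    rw [inversionDefect, inversionDefect, add_div, div_self h0, lerchSum_add_one, lerchSum_add_tau,
      add_right_comm, jacobiTheta₂_add_tau, hexp, hfactor]
    ring

theorem inversionDefect_neg (hτ : 0 < τ.im) (c κ : ℂ) {z : ℂ} (hz : OffLattice τ z) :
    inversionDefect τ c κ (-z) = -inversionDefect τ (-c)
      (τ - κ - (-I * τ) ^ (1 / 2 : ℂ) * e(c ^ 2 / (2 * τ))) z := by
  have h0 := ne_zero_of_im_pos hτ
  have htheta : jacobiTheta₂ (-z + c) τ = jacobiTheta₂ (z - c) τ := by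
    rw [← jacobiTheta₂_neg_left]
    ring_nf
  have hexp : e(-((-z) ^ 2 / (2 * τ)) - c * -z / τ) * e((z - c) ^ 2 / (2 * τ)) =
      e(c ^ 2 / (2 * τ)) := by
    rw [← exp_add]
    ring_nf
  rw [inversionDefect, inversionDefect, neg_div τ z, neg_div τ c,
    lerchSum_neg (im_neg_one_div_pos hτ) _ (hz.inversion h0), lerchSum_neg hτ _ hz, ← sub_div,
    jacobiTheta₂_inversion h0, htheta, ← sub_eq_add_neg]
  rw [show -(z ^ 2 / (2 * τ)) - -c * z / τ = -((-z) ^ 2 / (2 * τ)) - c * -z / τ by ring]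
  linear_combination (-I * τ) ^ (1 / 2 : ℂ) * jacobiTheta₂ (z - c) τ * hexp

theorem inversionDefect_sub_one (hτ : 0 < τ.im) (c κ : ℂ) {z : ℂ} (hz : OffLattice τ z) :
    inversionDefect τ (c - 1) κ z =
      inversionDefect τ c (κ - (-I * τ) ^ (1 / 2 : ℂ) * e(c ^ 2 / (2 * τ))) z := by
  have h0 := ne_zero_of_im_pos hτ
  have hlerch := exp_mul_lerchSum_add_tau_numerator (im_neg_one_div_pos hτ) (c / τ)
    (hz.inversion h0)
  rw [← add_div z c τ, jacobiTheta₂_inversion h0] at hlerch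
  have hexp : e(-(z ^ 2 / (2 * τ)) - (c - 1) * z / τ) =
      e(-(z ^ 2 / (2 * τ)) - c * z / τ) * e(z / τ) := by
    rw [← exp_add]
    ring_nf
  have hexp' : e(-(z ^ 2 / (2 * τ)) - c * z / τ) * e((z + c) ^ 2 / (2 * τ)) =
      e(c ^ 2 / (2 * τ)) := by
    rw [← exp_add]
    ring_nf
  have hperiod : lerchSum τ (c - 1) z = lerchSum τ c z := by
    rw [← lerchSum_add_one_numerator, sub_add_cancel]
  have htheta : jacobiTheta₂ (z + (c - 1)) τ = jacobiTheta₂ (z + c) τ := by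
    rw [← jacobiTheta₂_add_left]
    ring_nf
  rw [inversionDefect, inversionDefect, show (c - 1) / τ = c / τ + -1 / τ by ring, hexp, mul_assoc,
    hlerch, hperiod, htheta]
  linear_combination -(-I * τ) ^ (1 / 2 : ℂ) * jacobiTheta₂ (z + c) τ * hexp'

theorem inversionDefect_add_tau_numerator (hτ : 0 < τ.im) (c κ : ℂ) {z : ℂ}
    (hz : OffLattice τ z) :
    inversionDefect τ (c + τ) κ z =
      e(-z) * inversionDefect τ c (τ + κ * e(-c - τ / 2)) z := by
  have h0 := ne_zero_of_im_pos hτ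
  have hcancel : e(-z) * e(z) = 1 := by rw [← exp_add, mul_neg, neg_add_cancel, exp_zero]
  have hexp : e(-(z ^ 2 / (2 * τ)) - (c + τ) * z / τ) =
      e(-z) * e(-(z ^ 2 / (2 * τ)) - c * z / τ) := by
    rw [← exp_add]
    field_simp
    ring_nf
  have hfactor : e(-(z + c) - τ / 2) = e(-z) * e(-c - τ / 2) := by
    rw [← exp_add]
    ring_nf
  have hlerch := exp_mul_lerchSum_add_tau_numerator hτ c hz
  rw [inversionDefect, inversionDefect, add_div, div_self h0, lerchSum_add_one_numerator,
    ← add_assoc, jacobiTheta₂_add_tau, hexp, hfactor]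
  linear_combination -τ * e(-z) * hlerch + τ * lerchSum τ (c + τ) z * hcancel

theorem tendsto_mul_inversionDefect (hτ : 0 < τ.im) (c κ : ℂ) :
    Tendsto (fun z => z * inversionDefect τ c κ z) (𝓝[≠] 0) (𝓝 0) := by
  have h0 := ne_zero_of_im_pos hτ
  have hdiv : Tendsto (fun z : ℂ => z / τ) (𝓝[≠] 0) (𝓝[≠] 0) := by
    have hmaps : Set.MapsTo (fun z : ℂ => z / τ) {0}ᶜ {0 / τ}ᶜ := fun z hz => by
      simpa [h0] using hz
    have hcont : ContinuousWithinAt (fun z : ℂ => z / τ) {0}ᶜ 0 := by fun_prop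
    simpa using hcont.tendsto_nhdsWithin hmaps
  have hexp : Tendsto (fun z => τ * e(-(z ^ 2 / (2 * τ)) - c * z / τ)) (𝓝[≠] 0) (𝓝 τ) := by
    have hcont : Continuous fun z => τ * e(-(z ^ 2 / (2 * τ)) - c * z / τ) := by fun_prop
    simpa using (hcont.tendsto 0).mono_left nhdsWithin_le_nhds
  have htheta : Tendsto (fun z => z * (κ * jacobiTheta₂ (z + c) τ)) (𝓝[≠] 0) (𝓝 0) := by
    have hcont : Continuous fun z => z * (κ * jacobiTheta₂ (z + c) τ) := by
      have := (differentiable_jacobiTheta₂_fst hτ).continuous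
      fun_prop
    simpa using (hcont.tendsto 0).mono_left nhdsWithin_le_nhds
  have hinv := hexp.mul ((tendsto_mul_lerchSum (im_neg_one_div_pos hτ) (c / τ)).comp hdiv)
  have hlerch := (tendsto_mul_lerchSum hτ c).const_mul τ
  have hsum := (hinv.sub hlerch).add htheta
  rw [sub_self, add_zero] at hsum
  refine hsum.congr fun z => ?_
  rw [Function.comp_apply, inversionDefect]
  field_simp

theorem analyticAt_jacobiTheta₂_add (hτ : 0 < τ.im) (c z : ℂ) :
    AnalyticAt ℂ (fun z => jacobiTheta₂ (z + c) τ) z :=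
  ((differentiable_jacobiTheta₂_fst hτ).comp (differentiable_id.add_const c)).analyticAt z

theorem analyticAt_inversionDefect (hτ : 0 < τ.im) (c κ : ℂ) {z : ℂ} (hz : OffLattice τ z) :
    AnalyticAt ℂ (inversionDefect τ c κ) z := by
  have hinv : AnalyticAt ℂ (fun z => lerchSum (-1 / τ) (c / τ) (z / τ)) z :=
    (analyticAt_lerchSum (im_neg_one_div_pos hτ) (c / τ)
      (hz.inversion (ne_zero_of_im_pos hτ))).comp (f := fun z => z / τ) (by fun_prop)
  have hlerch := analyticAt_lerchSum hτ c hz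
  have htheta := analyticAt_jacobiTheta₂_add hτ c z
  unfold inversionDefect
  fun_prop

theorem meromorphic_inversionDefect (hτ : 0 < τ.im) (c κ : ℂ) :
    Meromorphic (inversionDefect τ c κ) := fun z => by
  have hinv : MeromorphicAt (fun z => lerchSum (-1 / τ) (c / τ) (z / τ)) z :=
    (meromorphic_lerchSum (im_neg_one_div_pos hτ) (c / τ) (z / τ)).comp_analyticAt
      (g := fun z => z / τ) (by fun_prop)
  have hlerch := meromorphic_lerchSum hτ c z
  have hexp : MeromorphicAt (fun z => e(-(z ^ 2 / (2 * τ)) - c * z / τ)) z :=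
    AnalyticAt.meromorphicAt (by fun_prop)
  have htheta := (analyticAt_jacobiTheta₂_add hτ c z).meromorphicAt
  unfold inversionDefect
  fun_prop

theorem inversionDefect_eq_zero_of_odd (hτ : 0 < τ.im) {c κ : ℂ} (m n : ℤ)
    (hodd : ∀ z, OffLattice τ z →
      inversionDefect τ c κ (m * τ + n - z) = -inversionDefect τ c κ z)
    {z : ℂ} (hz : OffLattice τ z) : inversionDefect τ c κ z = 0 :=
  (isThetaType_inversionDefect (ne_zero_of_im_pos hτ) c κ).eq_zero_of_odd_off_lattice
    (exp_ne_zero _) (meromorphic_inversionDefect hτ c κ)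
    (fun _ => analyticAt_inversionDefect hτ c κ) (tendsto_mul_inversionDefect hτ c κ) m n hodd hz

theorem inversionDefect_zero_eq_zero (hτ : 0 < τ.im) {z : ℂ} (hz : OffLattice τ z) :
    inversionDefect τ 0 ((τ - (-I * τ) ^ (1 / 2 : ℂ)) / 2) z = 0 := by
  refine inversionDefect_eq_zero_of_odd hτ 0 0 (fun w hw => ?_) hz
  have hexp : e((0 : ℂ) ^ 2 / (2 * τ)) = 1 := by simp
  rw [Int.cast_zero, zero_mul, zero_add, zero_sub, inversionDefect_neg hτ _ _ hw, neg_zero, hexp]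
  ring_nf

theorem inversionDefect_half_eq_zero (hτ : 0 < τ.im) {z : ℂ} (hz : OffLattice τ z) :
    inversionDefect τ (1 / 2) (τ / 2 - (-I * τ) ^ (1 / 2 : ℂ) * e(1 / (8 * τ))) z = 0 := by
  refine inversionDefect_eq_zero_of_odd hτ 0 0 (fun w hw => ?_) hz
  rw [Int.cast_zero, zero_mul, zero_add, zero_sub, inversionDefect_neg hτ _ _ hw,
    show -(1 / 2 : ℂ) = 1 / 2 - 1 by ring, inversionDefect_sub_one hτ _ _ hw]
  ring_nf

theorem inversionDefect_neg_half_tau_eq_zero (hτ : 0 < τ.im) {z : ℂ} (hz : OffLattice τ z) :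
    inversionDefect τ (-(τ / 2)) (τ - (-I * τ) ^ (1 / 2 : ℂ) * e(τ / 8) / 2) z = 0 := by
  have h0 := ne_zero_of_im_pos hτ
  refine inversionDefect_eq_zero_of_odd hτ 1 0 (fun w hw => ?_) hz
  have hcancel : e(-(-w)) * e(-w) = 1 := by
    rw [← exp_add, mul_neg _ (-w), neg_add_cancel, exp_zero]
  have hshift : -(-(τ / 2)) = -(τ / 2) + τ := by ring
  have hmul : e(-(τ / 2) + τ - τ / 2) = 1 := by
    rw [← exp_zero]
    ring_nf
  have hexp : e((-(τ / 2)) ^ 2 / (2 * τ)) = e(τ / 8) := by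
    field_simp
    ring_nf
  have hcoeff : τ + (τ - (τ - (-I * τ) ^ (1 / 2 : ℂ) * e(τ / 8) / 2) -
      (-I * τ) ^ (1 / 2 : ℂ) * e(τ / 8)) = τ - (-I * τ) ^ (1 / 2 : ℂ) * e(τ / 8) / 2 := by
    ring
  rw [Int.cast_one, one_mul, Int.cast_zero, add_zero, sub_eq_neg_add τ w,
    (isThetaType_inversionDefect h0 _ _).add_tau, inversionDefect_neg hτ _ _ hw, hexp,
    hshift, inversionDefect_add_tau_numerator hτ _ _ hw,
    hshift, hmul, mul_one, hcoeff, one_mul]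
  linear_combination -inversionDefect τ (-(τ / 2))
    (τ - (-I * τ) ^ (1 / 2 : ℂ) * e(τ / 8) / 2) w * hcancel

end Inversion

section Characteristics

/-- The Appell–Lerch sum with characteristics `a`, `b`, the summation running over `ℤ + a` and the
variable being translated by `b`. The numerator carries the further shift `c`, so that
`appellSum 0 0 c τ z = lerchSum τ c z`. -/
noncomputable def appellSum (a b c τ z : ℂ) : ℂ :=
  ∑' j : ℤ, e((j + a) * (z + b + c) + (j + a) ^ 2 / 2 * τ) / (1 - e(z + b + (j + a) * τ))

/-- The theta function with characteristics `a`, `b`: in this normalization Mumford's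
`ϑ_{ab}` has characteristics `a / 2`, `b / 2`. -/
noncomputable def thetaChar (a b τ z : ℂ) : ℂ :=
  e(a * (z + b) + a ^ 2 / 2 * τ) * jacobiTheta₂ (z + a * τ + b) τ

theorem appellSum_eq_lerchSum (a b c τ z : ℂ) :
    appellSum a b c τ z =
      e(a * (z + b + c) + a ^ 2 / 2 * τ) * lerchSum τ c (z + a * τ + b) := by
  rw [appellSum, lerchSum, ← tsum_mul_left]
  refine tsum_congr fun j => ?_
  rw [lerchTerm, jacobiTheta₂_term, ← mul_div_assoc, ← exp_add]
  ring_nf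

theorem appellSum_add_one_right (a b c τ z : ℂ) :
    appellSum a (b + 1) c τ z = e(a) * appellSum a b c τ z := by
  rw [appellSum_eq_lerchSum, appellSum_eq_lerchSum, ← add_assoc (z + a * τ), lerchSum_add_one,
    ← mul_assoc, ← exp_add]
  ring_nf

theorem appellSum_add_one_numerator (a b c τ z : ℂ) :
    appellSum a b (c + 1) τ z = e(a) * appellSum a b c τ z := by
  rw [appellSum_eq_lerchSum, appellSum_eq_lerchSum, lerchSum_add_one_numerator, ← mul_assoc,
    ← exp_add]
  ring_nf

theorem thetaChar_add_one_left (a b τ z : ℂ) : thetaChar (a + 1) b τ z = thetaChar a b τ z := by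
  rw [thetaChar, thetaChar, show z + (a + 1) * τ + b = z + a * τ + b + τ by ring,
    jacobiTheta₂_add_tau, ← mul_assoc, ← exp_add]
  ring_nf

theorem thetaChar_add_one_right (a b τ z : ℂ) :
    thetaChar a (b + 1) τ z = e(a) * thetaChar a b τ z := by
  rw [thetaChar, thetaChar, ← add_assoc (z + a * τ), jacobiTheta₂_add_left, ← mul_assoc,
    ← exp_add]
  ring_nf

theorem exists_sq_eq_add_two_mul (j : ℤ) : ∃ m : ℤ, j ^ 2 = j + 2 * m := by
  obtain ⟨m, hm⟩ := Int.even_mul_succ_self (j - 1)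
  exact ⟨m, by linear_combination hm⟩

theorem appellSum_add_one_tau (a b c τ z : ℂ) :
    appellSum a b c (τ + 1) z = e(-(a * (a + 1) / 2)) * appellSum a (b + a) (c + 1 / 2) τ z := by
  rw [appellSum, appellSum, ← tsum_mul_left]
  refine tsum_congr fun j => ?_
  obtain ⟨m, hm⟩ := exists_sq_eq_add_two_mul j
  have hm' : (j : ℂ) ^ 2 = j + 2 * m := by exact_mod_cast hm
  have hden : z + b + (j + a) * (τ + 1) = z + (b + a) + (j + a) * τ + j := by ring
  have hnum : (j + a) * (z + b + c) + (j + a) ^ 2 / 2 * (τ + 1) =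
      -(a * (a + 1) / 2) + ((j + a) * (z + (b + a) + (c + 1 / 2)) + (j + a) ^ 2 / 2 * τ) +
        m := by
    linear_combination hm' / 2
  rw [hden, hnum, exp_two_pi_I_mul_add_int, exp_two_pi_I_mul_add_int, ← mul_div_assoc, ← exp_add,
    ← mul_add]

theorem appellSum_inversion {τ z a b c κ : ℂ} (h0 : τ ≠ 0)
    (hdefect : inversionDefect τ c κ (z - a + b * τ) = 0) :
    appellSum a b (c / τ) (-1 / τ) (z / τ) =
      exp (π * I * z ^ 2 / τ) * e(c * z / τ + a * b) *
        (τ * appellSum b (-a) c τ z - κ * thetaChar b (-a) τ (z + c)) := by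
  set w := z - a + b * τ with hw
  have hexp : e(-(w ^ 2 / (2 * τ)) - c * w / τ) ≠ 0 := exp_ne_zero _
  have hinv : e(a * (z / τ + b + c / τ) + a ^ 2 / 2 * (-1 / τ)) =
      exp (π * I * z ^ 2 / τ) * e(c * z / τ + a * b) * e(b * (z + -a + c) + b ^ 2 / 2 * τ) *
        e(-(w ^ 2 / (2 * τ)) - c * w / τ) := by
    rw [← exp_add, ← exp_add, ← exp_add, hw]
    field_simp
    ring_nf
  have harg : z / τ + a * (-1 / τ) + b = w / τ := by
    rw [hw]
    field_simp
    ring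
  rw [inversionDefect] at hdefect
  rw [appellSum_eq_lerchSum, appellSum_eq_lerchSum, thetaChar, harg, hinv,
    show z + b * τ + -a = w by ring, show z + c + b * τ + -a = w + c by ring,
    show z + c + -a = z + -a + c by ring]
  linear_combination exp (π * I * z ^ 2 / τ) * e(c * z / τ + a * b) *
    e(b * (z + -a + c) + b ^ 2 / 2 * τ) * hdefect

theorem appellSum_zero_inversion {τ z a b : ℂ} (hτ : 0 < τ.im)
    (hz : OffLattice τ (z - a + b * τ)) :
    appellSum a b 0 (-1 / τ) (z / τ) = exp (π * I * z ^ 2 / τ) * e(a * b) *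
      (τ * appellSum b (-a) 0 τ z - 1 / 2 * τ * thetaChar b (-a) τ z +
        1 / 2 * (-I * τ) ^ (1 / 2 : ℂ) * thetaChar b (-a) τ z) := by
  have hinv := appellSum_inversion (ne_zero_of_im_pos hτ) (inversionDefect_zero_eq_zero hτ hz)
  rw [zero_div, zero_mul, zero_div, zero_add, add_zero] at hinv
  rw [hinv]
  ring

theorem appellSum_half_inversion {τ z a b : ℂ} (hτ : 0 < τ.im)
    (hz : OffLattice τ (z - a + b * τ)) :
    e(-(z / τ / 2)) * appellSum a b (-(-1 / τ / 2)) (-1 / τ) (z / τ) =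
      e(a * b) * (exp (π * I * z ^ 2 / τ) *
        (τ * appellSum b (-a) (1 / 2) τ z - 1 / 2 * τ * thetaChar b (-a + 1 / 2) τ z) +
          (-I * τ) ^ (1 / 2 : ℂ) * exp (π * I / τ * (z ^ 2 + 1 / 4)) *
            thetaChar b (-a + 1 / 2) τ z) := by
  have h0 := ne_zero_of_im_pos hτ
  have hinv := appellSum_inversion h0 (inversionDefect_half_eq_zero hτ hz)
  have htheta : thetaChar b (-a) τ (z + 1 / 2) = thetaChar b (-a + 1 / 2) τ z := by
    rw [thetaChar, thetaChar]
    ring_nf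
  have hcancel : e(-(z / τ / 2)) * e(1 / 2 * z / τ + a * b) = e(a * b) := by
    rw [← exp_add]
    ring_nf
  have hexp : exp (π * I / τ * (z ^ 2 + 1 / 4)) = exp (π * I * z ^ 2 / τ) * e(1 / (8 * τ)) := by
    rw [← exp_add]
    ring_nf
  rw [show -(-1 / τ / 2) = 1 / 2 / τ by ring, hinv, htheta, hexp, ← hcancel]
  ring

theorem exp_mul_thetaChar_sub_half_tau (a b τ z : ℂ) :
    e(-(z / 2)) * thetaChar a b τ (z + -(τ / 2)) =
      e(b / 2) * qPow τ (-1 / 8) * thetaChar (a - 1 / 2) b τ z := by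
  rw [thetaChar, thetaChar, qPow, ← mul_assoc, ← mul_assoc, ← exp_add, ← exp_add, ← exp_add]
  ring_nf

theorem exp_mul_qPow_neg_one_eighth (τ : ℂ) : e(τ / 8) * qPow τ (-1 / 8) = 1 := by
  have hexp : 2 * π * I * (τ / 8) + 2 * π * I * (-1 / 8) * τ = 0 := by ring
  rw [qPow, ← exp_add, hexp, exp_zero]

theorem appellSum_neg_half_tau_inversion {τ z a b : ℂ} (hτ : 0 < τ.im)
    (hz : OffLattice τ (z - a + b * τ)) :
    appellSum a b (1 / 2) (-1 / τ) (z / τ) = exp (π * I * z ^ 2 / τ) * e(a + a * b) *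
      (τ * (e(-(z / 2)) * appellSum b (-a) (-(τ / 2)) τ z) - e(-a / 2) *
        (τ * qPow τ (-1 / 8) * thetaChar (b - 1 / 2) (-a) τ z -
          1 / 2 * (-I * τ) ^ (1 / 2 : ℂ) * thetaChar (b - 1 / 2) (-a) τ z)) := by
  have h0 := ne_zero_of_im_pos hτ
  have hinv := appellSum_inversion h0 (inversionDefect_neg_half_tau_eq_zero hτ hz)
  have hperiod : appellSum a b (1 / 2) (-1 / τ) (z / τ) =
      e(a) * appellSum a b (-(1 / 2)) (-1 / τ) (z / τ) := by
    rw [← appellSum_add_one_numerator]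
    norm_num
  have hexp : e(-(τ / 2) * z / τ + a * b) = e(a * b) * e(-(z / 2)) := by
    rw [← exp_add]
    field_simp
    ring_nf
  have hadd : e(a + a * b) = e(a) * e(a * b) := by rw [mul_add, exp_add]
  have htheta := exp_mul_thetaChar_sub_half_tau b (-a) τ z
  have hq := exp_mul_qPow_neg_one_eighth τ
  rw [show -(τ / 2) / τ = -(1 / 2) by field_simp, hexp] at hinv
  rw [hperiod, hinv, hadd]
  linear_combination exp (π * I * z ^ 2 / τ) * e(a) * e(a * b) *
    (-(τ - (-I * τ) ^ (1 / 2 : ℂ) * e(τ / 8) / 2) * htheta +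
      (-I * τ) ^ (1 / 2 : ℂ) / 2 * e(-a / 2) * thetaChar (b - 1 / 2) (-a) τ z * hq)

end Characteristics

section MockTheta

theorem exp_two_pi_I_mul_half : e((1 / 2 : ℂ)) = -1 := by
  rw [show 2 * π * I * (1 / 2) = π * I by ring, exp_pi_mul_I]

theorem exp_two_pi_I_mul_neg_half : e(-(1 / 2 : ℂ)) = -1 := by
  rw [mul_neg, exp_neg, exp_two_pi_I_mul_half, inv_neg_one]

theorem exp_two_pi_I_mul_quarter : e((1 / 4 : ℂ)) = I := by
  rw [show 2 * π * I * (1 / 4) = π / 2 * I by ring, exp_pi_div_two_mul_I]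

theorem exp_two_pi_I_mul_neg_quarter : e(-(1 / 4 : ℂ)) = -I := by
  rw [mul_neg, exp_neg, exp_two_pi_I_mul_quarter, inv_I]

theorem neg_one_zpow_eq_exp (j : ℤ) : (-1 : ℂ) ^ j = e(j / 2) := by
  rw [← exp_pi_mul_I, ← exp_int_mul]
  ring_nf

theorem one_sub_exp_mul_qPow (τ z s : ℂ) :
    1 - exp (2 * π * I * z) * qPow τ s = 1 - e(z + s * τ) := by
  rw [qPow, mul_add, exp_add]
  ring_nf

theorem one_add_exp_mul_qPow (τ z s : ℂ) :
    1 + exp (2 * π * I * z) * qPow τ s = 1 - e(z + 1 / 2 + s * τ) := by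
  rw [← one_sub_exp_mul_qPow, mul_add, exp_add, exp_two_pi_I_mul_half]
  ring

theorem exp_mul_appellSum (w a b c τ z : ℂ) :
    e(w) * appellSum a b c τ z = ∑' j : ℤ,
      e(w + ((j + a) * (z + b + c) + (j + a) ^ 2 / 2 * τ)) / (1 - e(z + b + (j + a) * τ)) := by
  rw [appellSum, ← tsum_mul_left]
  refine tsum_congr fun j => ?_
  rw [mul_add _ w, exp_add _ (_ * (_ + _)), mul_div_assoc]

theorem f1_eq (τ z : ℂ) : f1 τ z = appellSum 0 0 0 τ z := by
  rw [f1, appellSum]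
  refine tsum_congr fun j => ?_
  rw [one_sub_exp_mul_qPow, qPow, ← exp_add]
  ring_nf

theorem f2_eq (τ z : ℂ) : f2 τ z = -I * appellSum (1 / 2) (1 / 2) 0 τ z := by
  rw [f2, ← exp_two_pi_I_mul_neg_quarter, exp_mul_appellSum]
  refine tsum_congr fun j => ?_
  rw [one_add_exp_mul_qPow, qPow, neg_one_zpow_eq_exp, ← exp_add, ← exp_add]
  ring_nf

theorem f3_eq (τ z : ℂ) : f3 τ z = appellSum 0 (1 / 2) 0 τ z := by
  rw [f3, appellSum]
  refine tsum_congr fun j => ?_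
  rw [one_add_exp_mul_qPow, qPow, neg_one_zpow_eq_exp, ← exp_add, ← exp_add]
  ring_nf

theorem f4_eq (τ z : ℂ) : f4 τ z = appellSum (1 / 2) 0 0 τ z := by
  rw [f4, appellSum]
  refine tsum_congr fun j => ?_
  rw [one_sub_exp_mul_qPow, qPow, ← exp_add]
  ring_nf

theorem g1_eq (τ z : ℂ) : g1 τ z = e(-(z / 2)) * appellSum 0 0 (-(τ / 2)) τ z := by
  rw [g1, exp_mul_appellSum]
  refine tsum_congr fun j => ?_
  rw [one_sub_exp_mul_qPow, qPow, ← exp_add]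
  ring_nf

theorem g2_eq (τ z : ℂ) : g2 τ z = e(-(z / 2)) * appellSum 0 (1 / 2) (-(τ / 2)) τ z := by
  rw [g2, exp_mul_appellSum]
  refine tsum_congr fun j => ?_
  rw [one_add_exp_mul_qPow, qPow, neg_one_zpow_eq_exp, ← exp_add, ← exp_add]
  ring_nf

theorem g3_eq (τ z : ℂ) : g3 τ z = e(-(z / 2)) * appellSum (1 / 2) 0 (-(τ / 2)) τ z := by
  rw [g3, exp_mul_appellSum]
  refine tsum_congr fun j => ?_
  rw [one_sub_exp_mul_qPow, qPow, ← exp_add]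
  ring_nf

theorem g4_eq (τ z : ℂ) :
    g4 τ z = -I * (e(-(z / 2)) * appellSum (1 / 2) (1 / 2) (-(τ / 2)) τ z) := by
  rw [g4, ← exp_two_pi_I_mul_neg_quarter, ← mul_assoc, ← exp_add, ← mul_add, exp_mul_appellSum]
  refine tsum_congr fun j => ?_
  rw [one_add_exp_mul_qPow, qPow, neg_one_zpow_eq_exp, ← exp_add, ← exp_add]
  ring_nf

theorem h1_eq (τ z : ℂ) : h1 τ z = appellSum 0 0 (1 / 2) τ z := by
  rw [h1, appellSum]
  refine tsum_congr fun j => ?_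
  rw [one_sub_exp_mul_qPow, qPow, neg_one_zpow_eq_exp, ← exp_add, ← exp_add]
  ring_nf

theorem h2_eq (τ z : ℂ) : h2 τ z = -I * appellSum (1 / 2) 0 (1 / 2) τ z := by
  rw [h2, ← exp_two_pi_I_mul_neg_quarter, exp_mul_appellSum]
  refine tsum_congr fun j => ?_
  rw [one_sub_exp_mul_qPow, qPow, neg_one_zpow_eq_exp, ← exp_add, ← exp_add]
  ring_nf

theorem h3_eq (τ z : ℂ) : h3 τ z = appellSum 0 (1 / 2) (1 / 2) τ z := by
  rw [h3, appellSum]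
  refine tsum_congr fun j => ?_
  rw [one_add_exp_mul_qPow, qPow, ← exp_add, show (j + 0) * (z + 1 / 2 + 1 / 2) +
    (j + 0) ^ 2 / 2 * τ = j * z + j ^ 2 / 2 * τ + j by ring, exp_two_pi_I_mul_add_int]
  ring_nf

theorem h4_eq (τ z : ℂ) : h4 τ z = -appellSum (1 / 2) (1 / 2) (1 / 2) τ z := by
  rw [h4, neg_eq_neg_one_mul, ← exp_two_pi_I_mul_neg_half, exp_mul_appellSum]
  refine tsum_congr fun j => ?_
  rw [one_add_exp_mul_qPow, qPow, ← exp_add,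
    show -(1 / 2) + ((j + 1 / 2) * (z + 1 / 2 + 1 / 2) + (j + 1 / 2) ^ 2 / 2 * τ) =
      (j + 1 / 2) * z + (j + 1 / 2) ^ 2 / 2 * τ + j by ring, exp_two_pi_I_mul_add_int]
  ring_nf

theorem theta00_eq (τ z : ℂ) : theta00 τ z = thetaChar 0 0 τ z := by
  simp [theta00, thetaChar]

theorem theta01_eq (τ z : ℂ) : theta01 τ z = thetaChar 0 (1 / 2) τ z := by
  simp [theta01, thetaChar]

theorem theta10_eq (τ z : ℂ) : theta10 τ z = thetaChar (1 / 2) 0 τ z := by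
  rw [theta10, thetaChar]
  ring_nf

theorem theta11_eq (τ z : ℂ) : theta11 τ z = thetaChar (1 / 2) (1 / 2) τ z := by
  rw [theta11, thetaChar]
  ring_nf

end MockTheta

section InversionTransformation

theorem appellSum_neg_half_right (a c τ z : ℂ) :
    appellSum a (-(1 / 2)) c τ z = e(-a) * appellSum a (1 / 2) c τ z := by
  have hadd := appellSum_add_one_right a (-(1 / 2)) c τ z
  rw [show -(1 / 2 : ℂ) + 1 = 1 / 2 by norm_num] at hadd
  rw [hadd, ← mul_assoc, ← exp_add, ← mul_add, neg_add_cancel, mul_zero, exp_zero, one_mul]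

theorem thetaChar_neg_half_right (a τ z : ℂ) :
    thetaChar a (-(1 / 2)) τ z = e(-a) * thetaChar a (1 / 2) τ z := by
  have hadd := thetaChar_add_one_right a (-(1 / 2)) τ z
  rw [show -(1 / 2 : ℂ) + 1 = 1 / 2 by norm_num] at hadd
  rw [hadd, ← mul_assoc, ← exp_add, ← mul_add, neg_add_cancel, mul_zero, exp_zero, one_mul]

theorem thetaChar_neg_half_left (b τ z : ℂ) :
    thetaChar (-(1 / 2)) b τ z = thetaChar (1 / 2) b τ z := by
  rw [← thetaChar_add_one_left]
  norm_num

variable {τ z : ℂ}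

theorem OffLattice.add_half_tau (hz : OffLattice τ (z - τ / 2)) :
    OffLattice τ (z + 1 / 2 * τ) := by
  convert hz.add_lattice 1 0 using 1
  push_cast
  ring

theorem OffLattice.sub_half_add_half_tau (hz : OffLattice τ (z - (1 + τ) / 2)) :
    OffLattice τ (z - 1 / 2 + 1 / 2 * τ) := by
  apply OffLattice.add_half_tau
  rwa [sub_sub, ← add_div]

theorem f1_inversion (hτ : 0 < τ.im) (hz : OffLattice τ z) :
    f1 (-1 / τ) (z / τ) = exp (π * I * z ^ 2 / τ) *
      (τ * f1 τ z - 1 / 2 * τ * theta00 τ z +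
        1 / 2 * (-I * τ) ^ (1 / 2 : ℂ) * theta00 τ z) := by
  have hinv := appellSum_zero_inversion (a := 0) (b := 0) hτ (by simpa using hz)
  simp only [neg_zero, mul_zero, exp_zero, mul_one] at hinv
  rw [f1_eq, f1_eq, theta00_eq, hinv]

theorem f2_inversion (hτ : 0 < τ.im) (hz : OffLattice τ (z - (1 + τ) / 2)) :
    f2 (-1 / τ) (z / τ) = exp (π * I * z ^ 2 / τ) *
      (-I * τ * f2 τ z + 1 / 2 * τ * theta11 τ z -
        1 / 2 * (-I * τ) ^ (1 / 2 : ℂ) * theta11 τ z) := by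
  rw [f2_eq, f2_eq, theta11_eq, appellSum_zero_inversion hτ hz.sub_half_add_half_tau,
    appellSum_neg_half_right, thetaChar_neg_half_right, exp_two_pi_I_mul_neg_half,
    show (1 / 2 : ℂ) * (1 / 2) = 1 / 4 by norm_num, exp_two_pi_I_mul_quarter]
  linear_combination exp (π * I * z ^ 2 / τ) *
    (1 / 2 * (-I * τ) ^ (1 / 2 : ℂ) - 1 / 2 * τ) * thetaChar (1 / 2) (1 / 2) τ z * I_sq

theorem f3_inversion (hτ : 0 < τ.im) (hz : OffLattice τ (z - τ / 2)) :
    f3 (-1 / τ) (z / τ) = exp (π * I * z ^ 2 / τ) *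
      (τ * f4 τ z - 1 / 2 * τ * theta10 τ z +
        1 / 2 * (-I * τ) ^ (1 / 2 : ℂ) * theta10 τ z) := by
  have hinv := appellSum_zero_inversion (a := 0) (b := 1 / 2) hτ
    (by simpa using hz.add_half_tau)
  simp only [neg_zero, zero_mul, mul_zero, exp_zero, mul_one] at hinv
  rw [f3_eq, f4_eq, theta10_eq, hinv]

theorem f4_inversion (hτ : 0 < τ.im) (hz : OffLattice τ (z - 1 / 2)) :
    f4 (-1 / τ) (z / τ) = exp (π * I * z ^ 2 / τ) *
      (τ * f3 τ z - 1 / 2 * τ * theta01 τ z +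
        1 / 2 * (-I * τ) ^ (1 / 2 : ℂ) * theta01 τ z) := by
  have hinv := appellSum_zero_inversion (a := 1 / 2) (b := 0) hτ (by simpa using hz)
  rw [appellSum_neg_half_right, thetaChar_neg_half_right] at hinv
  simp only [neg_zero, mul_zero, exp_zero, mul_one, one_mul] at hinv
  rw [f4_eq, f3_eq, theta01_eq, hinv]

theorem g1_inversion (hτ : 0 < τ.im) (hz : OffLattice τ z) :
    g1 (-1 / τ) (z / τ) =
      exp (π * I * z ^ 2 / τ) * (τ * h1 τ z - 1 / 2 * τ * theta01 τ z) +
        (-I * τ) ^ (1 / 2 : ℂ) * exp (π * I / τ * (z ^ 2 + 1 / 4)) * theta01 τ z := by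
  have hinv := appellSum_half_inversion (a := 0) (b := 0) hτ (by simpa using hz)
  simp only [neg_zero, mul_zero, exp_zero, one_mul, zero_add] at hinv
  rw [g1_eq, h1_eq, theta01_eq, hinv]

theorem g2_inversion (hτ : 0 < τ.im) (hz : OffLattice τ (z - τ / 2)) :
    g2 (-1 / τ) (z / τ) =
      exp (π * I * z ^ 2 / τ) * (I * τ * h2 τ z - 1 / 2 * τ * theta11 τ z) +
        (-I * τ) ^ (1 / 2 : ℂ) * exp (π * I / τ * (z ^ 2 + 1 / 4)) * theta11 τ z := by
  have hinv := appellSum_half_inversion (a := 0) (b := 1 / 2) hτ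
    (by simpa using hz.add_half_tau)
  simp only [neg_zero, zero_mul, mul_zero, exp_zero, one_mul, zero_add] at hinv
  rw [g2_eq, h2_eq, theta11_eq, hinv]
  linear_combination exp (π * I * z ^ 2 / τ) * τ * appellSum (1 / 2) 0 (1 / 2) τ z * I_sq

theorem g3_inversion (hτ : 0 < τ.im) (hz : OffLattice τ (z - 1 / 2)) :
    g3 (-1 / τ) (z / τ) =
      exp (π * I * z ^ 2 / τ) * (τ * h3 τ z - 1 / 2 * τ * theta00 τ z) +
        (-I * τ) ^ (1 / 2 : ℂ) * exp (π * I / τ * (z ^ 2 + 1 / 4)) * theta00 τ z := by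
  have hinv := appellSum_half_inversion (a := 1 / 2) (b := 0) hτ (by simpa using hz)
  rw [appellSum_neg_half_right, neg_add_cancel] at hinv
  simp only [neg_zero, mul_zero, exp_zero, one_mul] at hinv
  rw [g3_eq, h3_eq, theta00_eq, hinv]

theorem g4_inversion (hτ : 0 < τ.im) (hz : OffLattice τ (z - (1 + τ) / 2)) :
    g4 (-1 / τ) (z / τ) =
      exp (π * I * z ^ 2 / τ) * (τ * h4 τ z - 1 / 2 * τ * theta10 τ z) +
        (-I * τ) ^ (1 / 2 : ℂ) * exp (π * I / τ * (z ^ 2 + 1 / 4)) * theta10 τ z := by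
  rw [g4_eq, h4_eq, theta10_eq, appellSum_half_inversion hτ hz.sub_half_add_half_tau,
    appellSum_neg_half_right, neg_add_cancel, exp_two_pi_I_mul_neg_half,
    show (1 / 2 : ℂ) * (1 / 2) = 1 / 4 by norm_num, exp_two_pi_I_mul_quarter, ← mul_assoc (-I),
    neg_mul I I, I_mul_I]
  ring

theorem h1_inversion (hτ : 0 < τ.im) (hz : OffLattice τ z) :
    h1 (-1 / τ) (z / τ) = exp (π * I * z ^ 2 / τ) *
      (τ * g1 τ z - τ * qPow τ (-1 / 8) * theta10 τ z +
        1 / 2 * (-I * τ) ^ (1 / 2 : ℂ) * theta10 τ z) := by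
  have hinv := appellSum_neg_half_tau_inversion (a := 0) (b := 0) hτ (by simpa using hz)
  rw [zero_sub, thetaChar_neg_half_left] at hinv
  simp only [neg_zero, mul_zero, add_zero, zero_div, exp_zero, mul_one, one_mul] at hinv
  rw [h1_eq, g1_eq, theta10_eq, hinv, sub_add]

theorem h2_inversion (hτ : 0 < τ.im) (hz : OffLattice τ (z - 1 / 2)) :
    h2 (-1 / τ) (z / τ) = exp (π * I * z ^ 2 / τ) *
      (I * τ * g2 τ z + τ * qPow τ (-1 / 8) * theta11 τ z -
        1 / 2 * (-I * τ) ^ (1 / 2 : ℂ) * theta11 τ z) := by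
  have hinv := appellSum_neg_half_tau_inversion (a := 1 / 2) (b := 0) hτ (by simpa using hz)
  rw [appellSum_neg_half_right, zero_sub, thetaChar_neg_half_left, thetaChar_neg_half_right,
    show -(1 / 2 : ℂ) / 2 = -(1 / 4) by norm_num] at hinv
  simp only [neg_zero, mul_zero, add_zero, exp_zero, one_mul, exp_two_pi_I_mul_half,
    exp_two_pi_I_mul_neg_half, exp_two_pi_I_mul_neg_quarter] at hinv
  rw [h2_eq, g2_eq, theta11_eq, hinv]
  linear_combination exp (π * I * z ^ 2 / τ) * thetaChar (1 / 2) (1 / 2) τ z *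
    (1 / 2 * (-I * τ) ^ (1 / 2 : ℂ) - τ * qPow τ (-1 / 8)) * I_sq

theorem h3_inversion (hτ : 0 < τ.im) (hz : OffLattice τ (z - τ / 2)) :
    h3 (-1 / τ) (z / τ) = exp (π * I * z ^ 2 / τ) *
      (τ * g3 τ z - τ * qPow τ (-1 / 8) * theta00 τ z +
        1 / 2 * (-I * τ) ^ (1 / 2 : ℂ) * theta00 τ z) := by
  have hinv := appellSum_neg_half_tau_inversion (a := 0) (b := 1 / 2) hτ
    (by simpa using hz.add_half_tau)
  simp only [neg_zero, zero_mul, mul_zero, add_zero, zero_div, exp_zero, mul_one, one_mul,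
    sub_self] at hinv
  rw [h3_eq, g3_eq, theta00_eq, hinv, sub_add]

theorem h4_inversion (hτ : 0 < τ.im) (hz : OffLattice τ (z - (1 + τ) / 2)) :
    h4 (-1 / τ) (z / τ) = exp (π * I * z ^ 2 / τ) *
      (τ * g4 τ z - τ * qPow τ (-1 / 8) * theta01 τ z +
        1 / 2 * (-I * τ) ^ (1 / 2 : ℂ) * theta01 τ z) := by
  have hexp : e((1 / 2 + 1 / 2 * (1 / 2) : ℂ)) = -I := by
    rw [mul_add, exp_add, exp_two_pi_I_mul_half, show (1 / 2 : ℂ) * (1 / 2) = 1 / 4 by norm_num,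
      exp_two_pi_I_mul_quarter, neg_one_mul]
  rw [h4_eq, g4_eq, theta01_eq, appellSum_neg_half_tau_inversion hτ hz.sub_half_add_half_tau,
    appellSum_neg_half_right, sub_self, thetaChar_neg_half_right, hexp, exp_two_pi_I_mul_neg_half,
    show -(1 / 2 : ℂ) / 2 = -(1 / 4) by norm_num, exp_two_pi_I_mul_neg_quarter, neg_zero, mul_zero,
    exp_zero]
  linear_combination exp (π * I * z ^ 2 / τ) * thetaChar 0 (1 / 2) τ z *
    (τ * qPow τ (-1 / 8) - 1 / 2 * (-I * τ) ^ (1 / 2 : ℂ)) * I_sq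

end InversionTransformation

section Translation

theorem exp_pi_mul_I_div_four : exp (π * I / 4) = I * exp (-(π * I / 4)) := by
  nth_rw 1 [show π * I / 4 = 2 * π * I * (1 / 4) + -(π * I / 4) by ring]
  rw [exp_add, exp_two_pi_I_mul_quarter]

theorem appellSum_zero_add_one_tau (b c τ z : ℂ) :
    appellSum 0 b c (τ + 1) z = appellSum 0 b (c + 1 / 2) τ z := by
  simp [appellSum_add_one_tau]

theorem appellSum_half_add_one_tau (b c τ z : ℂ) :
    appellSum (1 / 2) b c (τ + 1) z =
      -exp (π * I / 4) * appellSum (1 / 2) (b + 1 / 2) (c + 1 / 2) τ z := by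
  rw [appellSum_add_one_tau, neg_eq_neg_one_mul (exp _), ← exp_two_pi_I_mul_neg_half, ← exp_add]
  ring_nf

theorem appellSum_half_half_add_half (c τ z : ℂ) :
    appellSum (1 / 2) (1 / 2 + 1 / 2) c τ z = -appellSum (1 / 2) 0 c τ z := by
  have hadd := appellSum_add_one_right (1 / 2) 0 c τ z
  rw [zero_add, exp_two_pi_I_mul_half, neg_one_mul] at hadd
  rw [add_halves, hadd]

theorem appellSum_half_add_half_numerator (a b τ z : ℂ) :
    appellSum a b (1 / 2 + 1 / 2) τ z = e(a) * appellSum a b 0 τ z := by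
  rw [add_halves, ← zero_add 1, appellSum_add_one_numerator]

theorem neg_half_add_one_tau (τ : ℂ) : -((τ + 1) / 2) + 1 / 2 = -(τ / 2) := by ring

theorem f1_translation (τ z : ℂ) : f1 (τ + 1) z = h1 τ z := by
  rw [f1_eq, h1_eq, appellSum_zero_add_one_tau, zero_add]

theorem f2_translation (τ z : ℂ) : f2 (τ + 1) z = exp (π * I / 4) * h2 τ z := by
  rw [f2_eq, h2_eq, appellSum_half_add_one_tau, appellSum_half_half_add_half, zero_add]
  ring

theorem f3_translation (τ z : ℂ) : f3 (τ + 1) z = h3 τ z := by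
  rw [f3_eq, h3_eq, appellSum_zero_add_one_tau, zero_add]

theorem f4_translation (τ z : ℂ) : f4 (τ + 1) z = exp (π * I / 4) * h4 τ z := by
  rw [f4_eq, h4_eq, appellSum_half_add_one_tau, zero_add, neg_mul_comm]

theorem g1_translation (τ z : ℂ) : g1 (τ + 1) z = g1 τ z := by
  rw [g1_eq, g1_eq, appellSum_zero_add_one_tau, neg_half_add_one_tau]

theorem g2_translation (τ z : ℂ) : g2 (τ + 1) z = g2 τ z := by
  rw [g2_eq, g2_eq, appellSum_zero_add_one_tau, neg_half_add_one_tau]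

theorem g3_translation (τ z : ℂ) : g3 (τ + 1) z = exp (-(π * I / 4)) * g4 τ z := by
  rw [g3_eq, g4_eq, appellSum_half_add_one_tau, neg_half_add_one_tau, zero_add,
    exp_pi_mul_I_div_four]
  ring

theorem g4_translation (τ z : ℂ) : g4 (τ + 1) z = exp (-(π * I / 4)) * g3 τ z := by
  rw [g4_eq, g3_eq, appellSum_half_add_one_tau, neg_half_add_one_tau, appellSum_half_half_add_half,
    exp_pi_mul_I_div_four]
  linear_combination -(exp (-(π * I / 4)) * e(-(z / 2)) *
    appellSum (1 / 2) 0 (-(τ / 2)) τ z) * I_sq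

theorem h1_translation (τ z : ℂ) : h1 (τ + 1) z = f1 τ z := by
  rw [h1_eq, f1_eq, appellSum_zero_add_one_tau, appellSum_half_add_half_numerator,
    mul_zero, exp_zero, one_mul]

theorem h2_translation (τ z : ℂ) : h2 (τ + 1) z = exp (π * I / 4) * f2 τ z := by
  rw [h2_eq, f2_eq, appellSum_half_add_one_tau, appellSum_half_add_half_numerator,
    exp_two_pi_I_mul_half, zero_add]
  ring

theorem h3_translation (τ z : ℂ) : h3 (τ + 1) z = f3 τ z := by
  rw [h3_eq, f3_eq, appellSum_zero_add_one_tau, appellSum_half_add_half_numerator,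
    mul_zero, exp_zero, one_mul]

theorem h4_translation (τ z : ℂ) : h4 (τ + 1) z = exp (π * I / 4) * f4 τ z := by
  rw [h4_eq, f4_eq, appellSum_half_add_one_tau, appellSum_half_half_add_half,
    appellSum_half_add_half_numerator, exp_two_pi_I_mul_half]
  ring

end Translation

end AppellSum

theorem mainTheorem6 (τ z : ℂ) (hτ : 0 < τ.im) :
    -- S-transformation
    ((OffLattice τ z →
      f1 (-1 / τ) (z / τ) = exp (π * I * z ^ 2 / τ) *
        (τ * f1 τ z - 1 / 2 * τ * theta00 τ z + 1 / 2 * (-I * τ) ^ (1 / 2 : ℂ) * theta00 τ z)) ∧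
     (OffLattice τ (z - (1 + τ) / 2) →
      f2 (-1 / τ) (z / τ) = exp (π * I * z ^ 2 / τ) *
        (-I * τ * f2 τ z + 1 / 2 * τ * theta11 τ z - 1 / 2 * (-I * τ) ^ (1 / 2 : ℂ) * theta11 τ z)) ∧
     (OffLattice τ (z - τ / 2) →
      f3 (-1 / τ) (z / τ) = exp (π * I * z ^ 2 / τ) *
        (τ * f4 τ z - 1 / 2 * τ * theta10 τ z + 1 / 2 * (-I * τ) ^ (1 / 2 : ℂ) * theta10 τ z)) ∧
     (OffLattice τ (z - 1 / 2) →
      f4 (-1 / τ) (z / τ) = exp (π * I * z ^ 2 / τ) *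
        (τ * f3 τ z - 1 / 2 * τ * theta01 τ z + 1 / 2 * (-I * τ) ^ (1 / 2 : ℂ) * theta01 τ z)) ∧
     (OffLattice τ z →
      g1 (-1 / τ) (z / τ) = exp (π * I * z ^ 2 / τ) * (τ * h1 τ z - 1 / 2 * τ * theta01 τ z) +
        (-I * τ) ^ (1 / 2 : ℂ) * exp (π * I / τ * (z ^ 2 + 1 / 4)) * theta01 τ z) ∧
     (OffLattice τ (z - τ / 2) →
      g2 (-1 / τ) (z / τ) = exp (π * I * z ^ 2 / τ) * (I * τ * h2 τ z - 1 / 2 * τ * theta11 τ z) +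
        (-I * τ) ^ (1 / 2 : ℂ) * exp (π * I / τ * (z ^ 2 + 1 / 4)) * theta11 τ z) ∧
     (OffLattice τ (z - 1 / 2) →
      g3 (-1 / τ) (z / τ) = exp (π * I * z ^ 2 / τ) * (τ * h3 τ z - 1 / 2 * τ * theta00 τ z) +
        (-I * τ) ^ (1 / 2 : ℂ) * exp (π * I / τ * (z ^ 2 + 1 / 4)) * theta00 τ z) ∧
     (OffLattice τ (z - (1 + τ) / 2) →
      g4 (-1 / τ) (z / τ) = exp (π * I * z ^ 2 / τ) * (τ * h4 τ z - 1 / 2 * τ * theta10 τ z) +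
        (-I * τ) ^ (1 / 2 : ℂ) * exp (π * I / τ * (z ^ 2 + 1 / 4)) * theta10 τ z) ∧
     (OffLattice τ z →
      h1 (-1 / τ) (z / τ) = exp (π * I * z ^ 2 / τ) *
        (τ * g1 τ z - τ * qPow τ (-1 / 8) * theta10 τ z +
          1 / 2 * (-I * τ) ^ (1 / 2 : ℂ) * theta10 τ z)) ∧
     (OffLattice τ (z - 1 / 2) →
      h2 (-1 / τ) (z / τ) = exp (π * I * z ^ 2 / τ) *
        (I * τ * g2 τ z + τ * qPow τ (-1 / 8) * theta11 τ z -
          1 / 2 * (-I * τ) ^ (1 / 2 : ℂ) * theta11 τ z)) ∧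
     (OffLattice τ (z - τ / 2) →
      h3 (-1 / τ) (z / τ) = exp (π * I * z ^ 2 / τ) *
        (τ * g3 τ z - τ * qPow τ (-1 / 8) * theta00 τ z +
          1 / 2 * (-I * τ) ^ (1 / 2 : ℂ) * theta00 τ z)) ∧
     (OffLattice τ (z - (1 + τ) / 2) →
      h4 (-1 / τ) (z / τ) = exp (π * I * z ^ 2 / τ) *
        (τ * g4 τ z - τ * qPow τ (-1 / 8) * theta01 τ z +
          1 / 2 * (-I * τ) ^ (1 / 2 : ℂ) * theta01 τ z))) ∧
    -- T-transformation
    ((OffLattice τ z → f1 (τ + 1) z = h1 τ z) ∧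
     (OffLattice τ (z - τ / 2) → f2 (τ + 1) z = exp (π * I / 4) * h2 τ z) ∧
     (OffLattice τ (z - 1 / 2) → f3 (τ + 1) z = h3 τ z) ∧
     (OffLattice τ (z - (1 + τ) / 2) → f4 (τ + 1) z = exp (π * I / 4) * h4 τ z) ∧
     (OffLattice τ z → g1 (τ + 1) z = g1 τ z) ∧
     (OffLattice τ (z - 1 / 2) → g2 (τ + 1) z = g2 τ z) ∧
     (OffLattice τ (z - (1 + τ) / 2) → g3 (τ + 1) z = exp (-(π * I / 4)) * g4 τ z) ∧
     (OffLattice τ (z - τ / 2) → g4 (τ + 1) z = exp (-(π * I / 4)) * g3 τ z) ∧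
     (OffLattice τ z → h1 (τ + 1) z = f1 τ z) ∧
     (OffLattice τ (z - (1 + τ) / 2) → h2 (τ + 1) z = exp (π * I / 4) * f2 τ z) ∧
     (OffLattice τ (z - 1 / 2) → h3 (τ + 1) z = f3 τ z) ∧
     (OffLattice τ (z - τ / 2) → h4 (τ + 1) z = exp (π * I / 4) * f4 τ z)) := by
  exact ⟨⟨f1_inversion hτ, f2_inversion hτ, f3_inversion hτ, f4_inversion hτ, g1_inversion hτ,
    g2_inversion hτ, g3_inversion hτ, g4_inversion hτ, h1_inversion hτ, h2_inversion hτ,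
    h3_inversion hτ, h4_inversion hτ⟩, ⟨fun _ => f1_translation τ z,
    fun _ => f2_translation τ z, fun _ => f3_translation τ z, fun _ => f4_translation τ z,
    fun _ => g1_translation τ z, fun _ => g2_translation τ z, fun _ => g3_translation τ z,
    fun _ => g4_translation τ z, fun _ => h1_translation τ z, fun _ => h2_translation τ z,
    fun _ => h3_translation τ z, fun _ => h4_translation τ z⟩⟩
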